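/- Let $k$ be an algebraically closed field and let $A\cong F/J$ be a finitely generated associative unital $k$-algebra, where $F=k\{x_1,\dots,x_m\}$ is the free associative algebra. For $n\ge 0$ let $V_n(A)=k[\xi_{lij}: 1\le l\le m,\ 1\le i,j\le n]/I$, where $I$ is the ideal generated by all entries of the matrices $p(\xi_1,\dots,\xi_m)$, $p\in J$, with $\xi_l=(\xi_{lij})_{i,j}$. Let $\eta_A:A\to M_n(V_n(A))$ be the universal representation $x_l\mapsto(\xi_{lij}+I)_{i,j}$, so that $\varphi\mapsto M_n(\varphi)\circ\eta_A$ is a bijection $\mathrm{Hom}(V_n(A),B)\cong\mathrm{Hom}(A,M_n(B))$ for every commutative $k$-algebra $B$, and put $\mathrm{Rep}_A^n=\mathrm{Spec}\,V_n(A)$. Let $M\in\mathrm{Rep}_A^n(k)$, with associated representation $\mu:A\to M_n(k)$, and let $f:V_n(A)\to k$ be the corresponding $k$-point, i.e. $M_n(f)\circ\eta_A=\mu$. For a local commutative $k$-algebra $(S,\mathfrak m)$ with residue field $k$, an $S$-deformation of $M$ is a $k$-algebra map $\widetilde\mu:A\to M_n(S)$ whose reduction modulo $\mathfrak m$ is $\mu$.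 For a commutative $k$-algebra $B$ and a $B$-module $N$, let $\mathrm{H}^2(B,N)$ be the second Hochschild cohomology of $B$ with values in the symmetric bimodule $N$ and let $\mathrm{Harr}^2(B,N)=\{[\omega]\in\mathrm{H}^2(B,N) : \omega \text{ is a symmetric } 2\text{-cocycle}\}$. Let ${}_fk$ be $k$ regarded as a $V_n(A)$-module via $f$. Then the following are equivalent: 1. $M$ is a regular point of $\mathrm{Rep}_A^n$, i.e. the localization of $V_n(A)$ at $\ker f$ is a regular local ring; 2. for all finite-dimensional local commutative $k$-algebras $S,T$, every surjective homomorphism of $k$-algebras $S\to T$ induces a surjection $\{S\text{-deformations of }M\}\to\{T\text{-deformations of }M\}$; 3. $\mathrm{Harr}^2(V_n(A),{}_fk)=0$. -/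

import Mathlib

/-! ### The scheme of `n`-dimensional representations

Throughout, `π : FreeAlgebra k (Fin m) →ₐ[k] A` is a surjection, i.e. a presentation `A ≅ F / J` with
`F` the free associative algebra on `m` letters and `J = ker π`. -/

universe u v w

namespace RepScheme

section Rep

variable {k : Type u} [Field k] {A : Type v} [Ring A] [Algebra k A] {m : ℕ}

/-- The generic matrices `ξ_l = (ξ_{l i j})` over `V_n(F) = k[ξ_{l i j}]`. -/
noncomputable def genericMatrix (k : Type u) [Field k] (m n : ℕ) (l : Fin m) :
    Matrix (Fin n) (Fin n) (MvPolynomial (Fin m × Fin n × Fin n) k) :=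
  Matrix.of fun i j => MvPolynomial.X (l, i, j)

/-- The evaluation `p ↦ p(ξ_1, …, ξ_m)` of noncommutative polynomials at the generic matrices. -/
noncomputable def genericEval (k : Type u) [Field k] (m n : ℕ) :
    FreeAlgebra k (Fin m) →ₐ[k]
      Matrix (Fin n) (Fin n) (MvPolynomial (Fin m × Fin n × Fin n) k) :=
  FreeAlgebra.lift k (genericMatrix k m n)

/-- The ideal of `V_n(F)` generated by all entries of `p(ξ_1, …, ξ_m)`, for `p` in `J = ker π`. -/
noncomputable def relIdeal (n : ℕ) (π : FreeAlgebra k (Fin m) →ₐ[k] A) :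
    Ideal (MvPolynomial (Fin m × Fin n × Fin n) k) :=
  Ideal.span {x | ∃ p : FreeAlgebra k (Fin m), π p = 0 ∧ ∃ i j, x = genericEval k m n p i j}

/-- The coordinate ring `V_n(A) = k[ξ_{l i j}] / I` of the scheme `Rep_A^n`. -/
abbrev V (n : ℕ) (π : FreeAlgebra k (Fin m) →ₐ[k] A) : Type u :=
  MvPolynomial (Fin m × Fin n × Fin n) k ⧸ relIdeal n π

/-- The map `F → M_n(V_n(A))`, `x_l ↦ (ξ_{l i j} + I)`. -/
noncomputable def etaFree (n : ℕ) (π : FreeAlgebra k (Fin m) →ₐ[k] A) :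
    FreeAlgebra k (Fin m) →ₐ[k] Matrix (Fin n) (Fin n) (V n π) :=
  (Ideal.Quotient.mkₐ k (relIdeal n π)).mapMatrix.comp (genericEval k m n)

theorem ker_le_ker_etaFree (n : ℕ) (π : FreeAlgebra k (Fin m) →ₐ[k] A) :
    RingHom.ker π ≤ RingHom.ker (etaFree n π) := by
  intro p hp
  rw [RingHom.mem_ker] at hp ⊢
  ext i j
  exact Ideal.Quotient.eq_zero_iff_mem.mpr (Ideal.subset_span ⟨p, hp, i, j, rfl⟩)

theorem etaFree_eq_of_eq (n : ℕ) (π : FreeAlgebra k (Fin m) →ₐ[k] A)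
    {p q : FreeAlgebra k (Fin m)} (h : π p = π q) : etaFree n π p = etaFree n π q := by
  have : p - q ∈ RingHom.ker (etaFree n π) :=
    ker_le_ker_etaFree n π (by rw [RingHom.mem_ker, map_sub, h, sub_self])
  rwa [RingHom.mem_ker, map_sub, sub_eq_zero] at this

/-- The universal `n`-dimensional representation `η_A : A → M_n(V_n(A))`. -/
noncomputable def eta (n : ℕ) (π : FreeAlgebra k (Fin m) →ₐ[k] A) (hπ : Function.Surjective π) :
    A →ₐ[k] Matrix (Fin n) (Fin n) (V n π) :=
  AlgHom.ofLinearMap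
    { toFun := fun a => etaFree n π (Function.surjInv hπ a)
      map_add' := fun a b => by
        rw [← map_add]
        exact etaFree_eq_of_eq n π (by simp only [map_add, Function.surjInv_eq hπ])
      map_smul' := fun r a => by
        rw [RingHom.id_apply, ← map_smul]
        exact etaFree_eq_of_eq n π (by simp only [map_smul, Function.surjInv_eq hπ]) }
    (by
      rw [← map_one (etaFree n π)]
      exact etaFree_eq_of_eq n π (by simp only [map_one, Function.surjInv_eq hπ]))
    (fun a b => by
      change etaFree n π _ = etaFree n π _ * etaFree n π _
      rw [← map_mul]
      exact etaFree_eq_of_eq n π (by simp only [map_mul, Function.surjInv_eq hπ]))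

theorem eta_apply (n : ℕ) (π : FreeAlgebra k (Fin m) →ₐ[k] A) (hπ : Function.Surjective π)
    (p : FreeAlgebra k (Fin m)) : eta n π hπ (π p) = etaFree n π p := by
  exact etaFree_eq_of_eq n π (Function.surjInv_eq hπ (π p))

/-- The evaluation of `V_n(F)` at the tuple of matrices `ρ(π(x_1)), …, ρ(π(x_m))`. -/
noncomputable def evalAt {n : ℕ} (π : FreeAlgebra k (Fin m) →ₐ[k] A) {B : Type w} [CommRing B]
    [Algebra k B] (ρ : A →ₐ[k] Matrix (Fin n) (Fin n) B) :
    MvPolynomial (Fin m × Fin n × Fin n) k →ₐ[k] B :=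
  MvPolynomial.aeval fun x => ρ (π (FreeAlgebra.ι k x.1)) x.2.1 x.2.2

theorem evalAt_comp_genericEval {n : ℕ} (π : FreeAlgebra k (Fin m) →ₐ[k] A) {B : Type w}
    [CommRing B] [Algebra k B] (ρ : A →ₐ[k] Matrix (Fin n) (Fin n) B) :
    (evalAt π ρ).mapMatrix.comp (genericEval k m n) = ρ.comp π := by
  apply FreeAlgebra.hom_ext
  funext l
  ext i j
  simp [genericEval, genericMatrix, evalAt]

/-- The point `V_n(A) → B` given by a representation `ρ : A → M_n(B)`. -/
noncomputable def pointOfRep {n : ℕ} (π : FreeAlgebra k (Fin m) →ₐ[k] A) {B : Type w} [CommRing B]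
    [Algebra k B] (ρ : A →ₐ[k] Matrix (Fin n) (Fin n) B) : V n π →ₐ[k] B :=
  Ideal.Quotient.liftₐ (relIdeal n π) (evalAt π ρ) fun a ha => by
    have : relIdeal n π ≤ RingHom.ker (evalAt π ρ) := by
      refine Ideal.span_le.mpr ?_
      rintro _ ⟨p, hp, i, j, rfl⟩
      have h := congrArg (fun M => M i j) (DFunLike.congr_fun (evalAt_comp_genericEval π ρ) p)
      simpa [hp] using h
    exact this ha

theorem pointOfRep_mk {n : ℕ} (π : FreeAlgebra k (Fin m) →ₐ[k] A) {B : Type w} [CommRing B]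
    [Algebra k B] (ρ : A →ₐ[k] Matrix (Fin n) (Fin n) B)
    (x : MvPolynomial (Fin m × Fin n × Fin n) k) :
    pointOfRep π ρ (Ideal.Quotient.mk (relIdeal n π) x) = evalAt π ρ x := rfl

/-- The adjunction `Hom(V_n(A), B) ≅ Hom(A, M_n(B))`, `φ ↦ M_n(φ) ∘ η_A`. -/
noncomputable def repEquiv (n : ℕ) (π : FreeAlgebra k (Fin m) →ₐ[k] A)
    (hπ : Function.Surjective π) (B : Type w) [CommRing B] [Algebra k B] :
    (V n π →ₐ[k] B) ≃ (A →ₐ[k] Matrix (Fin n) (Fin n) B) where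
  toFun φ := φ.mapMatrix.comp (eta n π hπ)
  invFun ρ := pointOfRep π ρ
  left_inv φ := by
    apply Ideal.Quotient.algHom_ext
    apply MvPolynomial.algHom_ext
    rintro ⟨l, i, j⟩
    simp [pointOfRep_mk, evalAt, eta_apply, etaFree, genericEval, genericMatrix]
  right_inv ρ := by
    ext a i j
    obtain ⟨p, rfl⟩ := hπ a
    have h := congrArg (fun M => M i j) (DFunLike.congr_fun (evalAt_comp_genericEval π ρ) p)
    simpa [pointOfRep_mk, eta_apply, etaFree] using h

/-- The point of `Spec R` underlying a `k`-point `f : R → k`, namely `ker f`. -/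
def underlyingPoint {R : Type w} [CommRing R] [Algebra k R] (f : R →ₐ[k] k) : PrimeSpectrum R :=
  ⟨RingHom.ker f, RingHom.ker_isPrime f⟩

end Rep

/-- A point `p` of `Spec R` is regular if the localization `R_p` is a regular local ring. -/
def IsRegularPoint {R : Type w} [CommRing R] (p : PrimeSpectrum R) : Prop :=
  IsRegularLocalRing (Localization.AtPrime p.asIdeal)

/-! ### Deformations of a representation -/

section Deformation

variable {k : Type u} [Field k] {A : Type v} [Ring A] [Algebra k A] {n : ℕ}

/-- For a local commutative `k`-algebra `S` with residue field `k`, an `S`-deformation of the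
representation `ρ : A → M_n(k)` is a representation `A → M_n(S)` that reduces to `ρ` modulo the
maximal ideal; the identification of `k` with the residue field is the structure map. -/
def Deformation (ρ : A →ₐ[k] Matrix (Fin n) (Fin n) k) (S : Type w) [CommRing S] [IsLocalRing S]
    [Algebra k S] : Type (max v w) :=
  {σ : A →ₐ[k] Matrix (Fin n) (Fin n) S //
    ∀ a, (σ a).map (IsLocalRing.residue S) =
      (ρ a).map (algebraMap k (IsLocalRing.ResidueField S))}

/-- The map from `S`-deformations to `T`-deformations induced by a surjection `φ : S → T`. -/
def Deformation.map (ρ : A →ₐ[k] Matrix (Fin n) (Fin n) k) {S T : Type w}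
    [CommRing S] [IsLocalRing S] [Algebra k S] [CommRing T] [IsLocalRing T] [Algebra k T]
    (φ : S →ₐ[k] T) (hφ : Function.Surjective φ) (σ : Deformation ρ S) : Deformation ρ T :=
  ⟨φ.mapMatrix.comp σ.1, fun a => by
    have : IsLocalHom (φ : S →+* T) := IsLocalHom.of_surjective _ hφ
    have h := congrArg (fun N => N.map (IsLocalRing.ResidueField.map (φ : S →+* T))) (σ.2 a)
    ext i j
    have hij := congrFun (congrFun h i) j
    simp only [Matrix.map_apply, IsLocalRing.ResidueField.map_residue] at hij
    simp only [AlgHom.comp_apply, AlgHom.mapMatrix_apply, Matrix.map_apply]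
    refine hij.trans ?_
    rw [IsScalarTower.algebraMap_apply k S (IsLocalRing.ResidueField S),
      IsScalarTower.algebraMap_apply k T (IsLocalRing.ResidueField T),
      IsLocalRing.ResidueField.algebraMap_eq, IsLocalRing.ResidueField.algebraMap_eq,
      IsLocalRing.ResidueField.map_residue]
    simp⟩

end Deformation

/-! ### Hochschild and Harrison cohomology in degree two -/

section Harrison

open scoped TensorProduct

variable (k : Type u) [Field k] (B : Type v) [CommRing B] [Algebra k B]
  (M : Type w) [AddCommGroup M] [Module k M] [Module B M] [IsScalarTower k B M]

/-- The Hochschild `2`-cocycles `ω : B ⊗ B → M` of the commutative algebra `B` with values in the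
symmetric bimodule `M`. -/
def cocycles₂ : Submodule k (B ⊗[k] B →ₗ[k] M) where
  carrier := {ω | ∀ a b c : B,
    a • ω (b ⊗ₜ c) - ω ((a * b) ⊗ₜ c) + ω (a ⊗ₜ (b * c)) - c • ω (a ⊗ₜ b) = 0}
  zero_mem' := by intro a b c; simp
  add_mem' := by
    intro ω ω' h h' a b c
    have e := congrArg₂ (· + ·) (h a b c) (h' a b c)
    simp only [LinearMap.add_apply, smul_add, add_zero] at e ⊢
    rw [← e]; abel
  smul_mem' := by
    intro r ω h a b c
    have e := congrArg (r • ·) (h a b c)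
    simp only [LinearMap.smul_apply, smul_zero, smul_sub, smul_add] at e ⊢
    rw [smul_comm a r, smul_comm c r]
    exact e

/-- The Hochschild `2`-coboundaries: the cocycles of the form `a ⊗ b ↦ a g(b) - g(ab) + g(a) b`
for a `k`-linear map `g : B → M`. -/
def coboundaries₂ : Submodule k (cocycles₂ k B M) where
  carrier := {ω | ∃ g : B →ₗ[k] M, ∀ a b : B, ω.1 (a ⊗ₜ b) = a • g b - g (a * b) + b • g a}
  zero_mem' := ⟨0, by intro a b; simp⟩
  add_mem' := by
    rintro ω ω' ⟨g, h⟩ ⟨g', h'⟩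
    refine ⟨g + g', fun a b => ?_⟩
    simp only [Submodule.coe_add, LinearMap.add_apply, h, h', smul_add]
    abel
  smul_mem' := by
    rintro r ω ⟨g, h⟩
    refine ⟨r • g, fun a b => ?_⟩
    simp only [Submodule.coe_smul, LinearMap.smul_apply, h, smul_add, smul_sub, smul_comm a r,
      smul_comm b r]

/-- The second Hochschild cohomology group: `2`-cocycles modulo `2`-coboundaries. -/
abbrev H2 : Type _ := cocycles₂ k B M ⧸ coboundaries₂ k B M

/-- The symmetric `2`-cocycles. -/
def symmetricCocycles₂ : Submodule k (cocycles₂ k B M) where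
  carrier := {ω | ∀ a b : B, ω.1 (a ⊗ₜ b) = ω.1 (b ⊗ₜ a)}
  zero_mem' := by intro a b; simp
  add_mem' := by intro ω ω' h h' a b; simp [h a b, h' a b]
  smul_mem' := by intro r ω h a b; simp [h a b]

/-- The second Harrison cohomology group: the classes `[ω]` in the second Hochschild cohomology
group of symmetric `2`-cocycles `ω`. -/
def Harr2 : Submodule k (H2 k B M) :=
  (symmetricCocycles₂ k B M).map (coboundaries₂ k B M).mkQ

end Harrison

section Restriction

variable {k : Type u} [Field k] {B : Type v} [CommRing B] [Algebra k B]

/-- The `B`-module `_f k`: the vector space `k` with `b • x = f b * x`. -/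
def PointModule (_f : B →ₐ[k] k) : Type u := k

noncomputable instance (f : B →ₐ[k] k) : AddCommGroup (PointModule f) :=
  inferInstanceAs (AddCommGroup k)

noncomputable instance (f : B →ₐ[k] k) : Module k (PointModule f) :=
  inferInstanceAs (Module k k)

noncomputable instance (f : B →ₐ[k] k) : Module B (PointModule f) :=
  Module.compHom k f.toRingHom

instance (f : B →ₐ[k] k) : IsScalarTower k B (PointModule f) where
  smul_assoc r b x := by
    change f (r • b) * (show k from x) = r * (f b * (show k from x))
    rw [map_smul, smul_eq_mul, mul_assoc]

end Restriction

end RepScheme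

/-! All three conditions depend only on `B = V n π` and the point `f`, and each is compared with one
property, `AlgHom.HasArtinianLifting`. For deformations this is the adjunction `repEquiv`: an
`S`-deformation is a map `B → S` centred at `f`.

Regularity is tested on the localization `L`, which poses the same lifting problems. Let `y` be `d`
generators of its maximal ideal `𝔪`. The comparison `k[t]/(t)^j → L/𝔪^j` is always onto. If it fails
to be injective, a nonzero form of some degree `i < j` vanishes at `y` to order `i + 1`. Cutting by
`d - 1` linear forms through a point where that form does not vanish puts `𝔪^i` in an ideal with
fewer than `d` generators. For `d = dim L` this contradicts Krull's height theorem, so the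
truncations of a regular `L` are truncated polynomial rings and maps out of them lift variable by
variable. Conversely, let `d` be the embedding dimension. Lifting `L → L/𝔪² ≅ k[t]/(t)²` to higher
truncations preserves leading forms, so the comparison is injective in every order. Then the
colength of `𝔪^j` grows like `j^d`, whereas a system of parameters bounds it by a constant times
`j^(dim L)`; hence `d ≤ dim L`.

For Harrison cohomology, a surjection is filtered by small ones, whose kernel is a line killed by
the maximal ideal. The failure of a linear lift to be multiplicative is a symmetric cocycle, and a
cobounding function corrects it. Conversely a symmetric cocycle defines a square-zero extension of
`B` by `k`. Krull's intersection theorem gives a finite-dimensional truncation in which `k`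
survives, and lifting into it exhibits the cocycle as a coboundary. -/

open IsLocalRing MvPolynomial

/-! ### Forms and powers of the ideal of the variables -/

namespace MvPolynomial

theorem aeval_algebraMap_mul_of_isHomogeneous {σ R B : Type*} [CommSemiring R] [CommSemiring B]
    [Algebra R B] {g : MvPolynomial σ R} {i : ℕ} (hg : g.IsHomogeneous i) (a : σ → R) (z : B) :
    aeval (fun s => algebraMap R B (a s) * z) g = algebraMap R B (eval a g) * z ^ i := by
  rw [MvPolynomial.aeval_def, eval₂_eq, eval_eq, map_sum, Finset.sum_mul]
  refine Finset.sum_congr rfl fun x hx => ?_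
  have hx : x.degree = i := by
    have := hg (mem_support_iff.mp hx)
    rwa [Finsupp.degree_eq_weight_one] 
  simp only [mul_pow, Finset.prod_mul_distrib, map_mul, map_prod, map_pow]
  rw [Finset.prod_pow_eq_pow_sum, ← hx, Finsupp.degree_apply, mul_assoc]

theorem mem_pow_idealOfVars_succ_iff {σ R : Type*} [CommRing R] {p : MvPolynomial σ R} {j : ℕ}
    (hp : p ∈ idealOfVars σ R ^ j) :
    p ∈ idealOfVars σ R ^ (j + 1) ↔ homogeneousComponent j p = 0 := by
  rw [mem_pow_idealOfVars_iff'] at hp ⊢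
  constructor
  · intro h
    ext x
    rw [coeff_homogeneousComponent, coeff_zero]
    split_ifs with hx
    · exact h x (by omega)
    · rfl
  · intro h x hx
    rcases (Nat.lt_succ_iff.mp hx).lt_or_eq with hx | hx
    · exact hp x hx
    · have := congrArg (coeff x) h
      rwa [coeff_homogeneousComponent, if_pos hx, coeff_zero] at this

theorem sub_homogeneousComponent_mem {σ R : Type*} [CommRing R] {p : MvPolynomial σ R} {j : ℕ}
    (hp : p ∈ idealOfVars σ R ^ j) :
    p - homogeneousComponent j p ∈ idealOfVars σ R ^ (j + 1) := by
  rw [mem_pow_idealOfVars_iff'] at hp ⊢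
  intro x hx
  rw [coeff_sub, coeff_homogeneousComponent]
  split_ifs with hxj
  · exact sub_self _
  · rw [hp x (by omega), sub_zero]

theorem map_pow_idealOfVars_le {σ R B : Type*} [CommRing R] [CommRing B] [Algebra R B]
    (α : MvPolynomial σ R →ₐ[R] B) {I : Ideal B} (hα : ∀ s, α (X s) ∈ I) (j : ℕ) :
    (idealOfVars σ R ^ j).map α ≤ I ^ j := by
  rw [Ideal.map_pow]
  refine Ideal.pow_right_mono ?_ j
  rw [Ideal.map_span, Ideal.span_le]
  rintro _ ⟨_, ⟨s, rfl⟩, rfl⟩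
  exact hα s

end MvPolynomial

/-! ### Forms vanishing to higher order in a local ring -/

section LocalAlgebra

variable {k : Type*} [Field k] {L : Type*} [CommRing L] [IsLocalRing L] [Algebra k L]

theorem aeval_mem_pow_of_mem_pow_idealOfVars {d : ℕ} {y : Fin d → L}
    (hy : Ideal.span (Set.range y) = maximalIdeal L) {p : MvPolynomial (Fin d) k} {j : ℕ}
    (hp : p ∈ idealOfVars (Fin d) k ^ j) : aeval y p ∈ maximalIdeal L ^ j := by
  refine map_pow_idealOfVars_le (aeval y) (I := maximalIdeal L) (fun s => ?_) j
    (Ideal.mem_map_of_mem _ hp)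
  rw [aeval_X, ← hy]
  exact Ideal.subset_span ⟨s, rfl⟩

/-- If a nonzero form of degree `i` in generators of the maximal ideal vanishes to order `i + 1`,
then some ideal with fewer generators contains the `i`-th power of the maximal ideal. -/
theorem exists_pow_maximalIdeal_le_span [IsNoetherianRing L] [Infinite k] {d : ℕ} {y : Fin d → L}
    (hy : Ideal.span (Set.range y) = maximalIdeal L) {g : MvPolynomial (Fin d) k} {i : ℕ}
    (hg : g.IsHomogeneous i) (hi : i ≠ 0) (hg0 : g ≠ 0)
    (h : aeval y g ∈ maximalIdeal L ^ (i + 1)) :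
    ∃ s : Finset L, s.card < d ∧ Ideal.span (s : Set L) ≤ maximalIdeal L ∧
      maximalIdeal L ^ i ≤ Ideal.span (s : Set L) := by
  classical
  obtain ⟨a, ha⟩ : ∃ a, eval a g ≠ 0 := by
    by_contra! hc
    exact hg0 (hg.eq_zero_of_forall_eval_eq_zero hc)
  -- A form of positive degree vanishes at the origin, so `a` is not the origin.
  obtain ⟨r, hr⟩ : ∃ r, a r ≠ 0 := by
    by_contra! hc
    have := aeval_algebraMap_mul_of_isHomogeneous hg a (0 : k)
    rw [zero_pow hi, mul_zero] at this
    apply ha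
    simpa [show a = fun _ => 0 from funext hc, coe_aeval_eq_eval] using this
  have hym : ∀ s, y s ∈ maximalIdeal L := fun s => hy ▸ Ideal.subset_span ⟨s, rfl⟩
  -- These are the linear forms vanishing on the line through `a`. The one with index `r` is zero,
  -- which leaves `d - 1` of them.
  let z : Fin d → L := fun s => y s - algebraMap k L (a s * (a r)⁻¹) * y r
  let S : Finset L := (Finset.univ.erase r).image z
  have hSm : Ideal.span (S : Set L) ≤ maximalIdeal L := by
    rw [Ideal.span_le]
    intro x hx
    obtain ⟨s, -, rfl⟩ := Finset.mem_image.mp hx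
    exact sub_mem (hym s) (Ideal.mul_mem_left _ _ (hym r))
  refine ⟨S, ?_, hSm, ?_⟩
  · refine Finset.card_image_le.trans_lt ?_
    rw [Finset.card_erase_of_mem (Finset.mem_univ r), Finset.card_univ, Fintype.card_fin]
    have := r.pos
    omega
  set K := Ideal.span (S : Set L)
  let q := Ideal.Quotient.mkₐ k K
  have hq : ∀ s, q (y s) = algebraMap k (L ⧸ K) (a s * (a r)⁻¹) * q (y r) := by
    intro s
    have : z s ∈ K := by
      by_cases hs : s = r
      · have : z s = 0 := by simp only [z, hs, mul_inv_cancel₀ hr, map_one, one_mul, sub_self]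
        rw [this]; exact zero_mem _
      · exact Ideal.subset_span (Finset.mem_coe.mpr (Finset.mem_image.mpr
          ⟨s, Finset.mem_erase.mpr ⟨hs, Finset.mem_univ _⟩, rfl⟩))
    have h0 : q (z s) = 0 := Ideal.Quotient.eq_zero_iff_mem.mpr this
    rw [map_sub, map_mul, AlgHom.commutes] at h0
    exact sub_eq_zero.mp h0
  -- Modulo `K` the tuple `y` is proportional to `a`, so the form becomes a nonzero scalar times the
  -- `i`-th power of `y r`, which generates the image of the maximal ideal.
  have hgq : q (aeval y g) = algebraMap k _ (eval a g * (a r)⁻¹ ^ i) * q (y r) ^ i := by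
    have e1 : eval (fun s => a s * (a r)⁻¹) g = eval a g * (a r)⁻¹ ^ i := by
      have := aeval_algebraMap_mul_of_isHomogeneous hg a ((a r)⁻¹ : k)
      simpa using! this
    rw [← e1, ← aeval_algebraMap_mul_of_isHomogeneous hg, ← funext hq, comp_aeval_apply]
  have hyr : q (y r) ^ i ∈ (maximalIdeal L ^ (i + 1)).map q := by
    have h1 := Ideal.mul_mem_left _ (algebraMap k _ (eval a g * (a r)⁻¹ ^ i)⁻¹)
      (Ideal.mem_map_of_mem q h)
    rw [hgq, ← mul_assoc, ← map_mul, inv_mul_cancel₀, map_one, one_mul] at h1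
    · exact h1
    · exact mul_ne_zero ha (pow_ne_zero _ (inv_ne_zero hr))
  have hm : (maximalIdeal L).map q ≤ Ideal.span {q (y r)} := by
    rw [← hy, Ideal.map_span, Ideal.span_le]
    rintro _ ⟨_, ⟨s, rfl⟩, rfl⟩
    rw [hq s]
    exact Ideal.mul_mem_left _ _ (Ideal.mem_span_singleton_self _)
  have hmi : (maximalIdeal L ^ i).map q ≤ (maximalIdeal L ^ (i + 1)).map q := by
    rw [Ideal.map_pow]
    refine (Ideal.pow_right_mono hm i).trans ?_
    rw [Ideal.span_singleton_pow, Ideal.span_singleton_le_iff_mem]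
    exact hyr
  -- Nakayama: it remains to see that `𝔪^i ≤ K + 𝔪 · 𝔪^i`.
  refine Submodule.le_of_le_smul_of_le_jacobson_bot (I := maximalIdeal L)
    (IsNoetherian.noetherian _) (jacobson_eq_maximalIdeal ⊥ bot_ne_top).ge ?_
  rw [smul_eq_mul, ← pow_succ']
  intro x hx
  obtain ⟨w, hw, hwx⟩ := (Ideal.mem_map_iff_of_surjective q Ideal.Quotient.mk_surjective).mp
    (hmi (Ideal.mem_map_of_mem q hx))
  have : x - w ∈ K := Ideal.Quotient.eq.mp hwx.symm
  rw [← sub_add_cancel x w]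
  exact Submodule.add_mem_sup this hw

/-- The comparison `k[t₁, …, t_d] ⧸ (t)^j → L ⧸ 𝔪^j` is injective as long as no ideal with fewer
than `d` generators contains a power `𝔪^i` with `i < j`. -/
theorem mem_pow_idealOfVars_of_aeval_mem [IsNoetherianRing L] [Infinite k] {d : ℕ} {y : Fin d → L}
    (hy : Ideal.span (Set.range y) = maximalIdeal L) (j : ℕ)
    (hj : ∀ i < j, ∀ s : Finset L, s.card < d → Ideal.span (s : Set L) ≤ maximalIdeal L →
      ¬ maximalIdeal L ^ i ≤ Ideal.span (s : Set L))
    {p : MvPolynomial (Fin d) k} (hp : aeval y p ∈ maximalIdeal L ^ j) :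
    p ∈ idealOfVars (Fin d) k ^ j := by
  induction j with
  | zero => simp
  | succ j ih =>
    have hpj := ih (fun i hi => hj i (by omega)) (Ideal.pow_le_pow_right (Nat.le_succ j) hp)
    rw [mem_pow_idealOfVars_succ_iff hpj]
    have hg : aeval y (homogeneousComponent j p) ∈ maximalIdeal L ^ (j + 1) := by
      have := sub_mem hp (aeval_mem_pow_of_mem_pow_idealOfVars hy
        (sub_homogeneousComponent_mem hpj))
      rwa [map_sub, sub_sub_cancel] at this
    by_contra hne
    -- A nonzero form of degree zero is a unit of `L`, so it cannot lie in the maximal ideal.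
    have hj0 : j ≠ 0 := by
      rintro rfl
      rw [homogeneousComponent_zero] at hg hne
      rw [algHom_C, zero_add, pow_one] at hg
      have hc : coeff 0 p ≠ 0 := fun h => hne (by rw [h, map_zero])
      exact hg ((IsUnit.mk0 _ hc).map (algebraMap k L))
    obtain ⟨s, hs, hsm, hle⟩ := exists_pow_maximalIdeal_le_span hy
      (homogeneousComponent_isHomogeneous j p) hj0 hne hg
    exact hj j (Nat.lt_succ_self j) s hs hsm hle

/-- Otherwise the maximal ideal is minimal over the span of `s`, and Krull's height theorem bounds
the dimension by `s.card`. -/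
theorem not_pow_maximalIdeal_le_span_of_lt_ringKrullDim [IsNoetherianRing L] {s : Finset L}
    (hs : (s.card : WithBot ℕ∞) < ringKrullDim L) (hsm : Ideal.span (s : Set L) ≤ maximalIdeal L)
    (i : ℕ) : ¬ maximalIdeal L ^ i ≤ Ideal.span (s : Set L) := by
  intro hle
  have hmin : maximalIdeal L ∈ (Ideal.span (s : Set L)).minimalPrimes := by
    refine ⟨⟨inferInstance, hsm⟩, ?_⟩
    rintro P ⟨hP, hPs⟩ -
    exact hP.le_of_pow_le (hle.trans hPs)
  have := Ideal.height_le_card_of_mem_minimalPrimes_span_finset hmin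
  rw [← maximalIdeal_height_eq_ringKrullDim] at hs
  exact absurd hs (not_lt.mpr (by exact_mod_cast this))

/-- For `i ≤ 1` the inclusion would make `s` a generating set of the maximal ideal. This gives the
comparison with polynomials up to order two without any regularity. -/
theorem not_pow_maximalIdeal_le_span_of_lt_spanFinrank [IsNoetherianRing L] {s : Finset L}
    (hs : s.card < (maximalIdeal L).spanFinrank)
    (hsm : Ideal.span (s : Set L) ≤ maximalIdeal L) {i : ℕ} (hi : i < 2) :
    ¬ maximalIdeal L ^ i ≤ Ideal.span (s : Set L) := by
  intro hle
  have hle : maximalIdeal L ≤ Ideal.span (s : Set L) := by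
    interval_cases i
    · rw [pow_zero, Ideal.one_eq_top, top_le_iff] at hle
      exact le_top.trans hle.ge
    · simpa using hle
  have := Submodule.spanFinrank_span_le_ncard_of_finite (R := L) s.finite_toSet
  rw [Set.ncard_coe_finset] at this
  have heq : maximalIdeal L = Submodule.span L (s : Set L) := hle.antisymm hsm
  rw [← heq] at this
  omega

variable (L) in
theorem exists_span_range_eq_maximalIdeal [IsNoetherianRing L] :
    ∃ y : Fin (maximalIdeal L).spanFinrank → L, Ideal.span (Set.range y) = maximalIdeal L := by
  obtain ⟨s, hs, hs'⟩ := Submodule.FG.exists_span_finset_card_eq_spanFinrank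
    (IsNoetherian.noetherian (maximalIdeal L))
  refine ⟨fun i => (s.equivFin.symm (Fin.cast hs.symm i) : L), ?_⟩
  refine Eq.trans (congrArg Ideal.span ?_) hs'
  ext x
  constructor
  · rintro ⟨i, rfl⟩
    exact (s.equivFin.symm _).2
  · intro hx
    exact ⟨Fin.cast hs (s.equivFin ⟨x, hx⟩), by simp⟩

end LocalAlgebra

/-! ### Truncations of an augmented algebra -/

section Augmented

variable {k : Type*} [Field k] {B : Type*} [CommRing B] [Algebra k B] (f : B →ₐ[k] k)

theorem AlgHom.surjective_of_augmentation : Function.Surjective f := fun c =>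
  ⟨algebraMap k B c, f.commutes c⟩

theorem AlgHom.isMaximal_ker_of_augmentation : (RingHom.ker f).IsMaximal :=
  RingHom.ker_isMaximal_of_surjective f f.surjective_of_augmentation

theorem AlgHom.sub_algebraMap_mem_ker (x : B) : x - algebraMap k B (f x) ∈ RingHom.ker f := by
  rw [RingHom.mem_ker, map_sub, f.commutes, Algebra.algebraMap_self_apply, sub_self]

theorem Ideal.isLocalRing_quotient_pow {B : Type*} [CommRing B] (m : Ideal B) [hm : m.IsMaximal]
    {j : ℕ} (hj : j ≠ 0) : IsLocalRing (B ⧸ m ^ j) := by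
  refine IsLocalRing.of_unique_max_ideal ⟨m.map (Ideal.Quotient.mk (m ^ j)), ?_, ?_⟩
  · refine (Ideal.map_eq_top_or_isMaximal_of_surjective _ Ideal.Quotient.mk_surjective
      hm).resolve_left fun h => hm.ne_top ?_
    have := congrArg (Ideal.comap (Ideal.Quotient.mk (m ^ j))) h
    rwa [Ideal.comap_map_of_surjective _ Ideal.Quotient.mk_surjective, Ideal.comap_top,
      ← RingHom.ker_eq_comap_bot, Ideal.mk_ker, sup_eq_left.mpr (Ideal.pow_le_self hj)] at this
  · intro M hM
    have h1 : m ≤ M.comap (Ideal.Quotient.mk (m ^ j)) := by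
      have := hM.isPrime
      refine Ideal.IsPrime.le_of_pow_le (n := j) fun x hx => ?_
      rw [Ideal.mem_comap, Ideal.Quotient.eq_zero_iff_mem.mpr hx]
      exact zero_mem _
    have h2 : (M.comap (Ideal.Quotient.mk (m ^ j))) ≠ ⊤ := Ideal.comap_ne_top _ hM.ne_top
    exact (Ideal.map_comap_of_surjective _ Ideal.Quotient.mk_surjective M).symm.trans
      (congrArg (Ideal.map _) (hm.eq_of_le h2 h1).symm)

/-- For `j ≠ 0` the induced map to `k` has a finitely generated nilpotent kernel, so finiteness
passes from `k` to the quotient. -/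
theorem AlgHom.finite_quotient_ker_pow (hf : (RingHom.ker f).FG) (j : ℕ) :
    Module.Finite k (B ⧸ RingHom.ker f ^ j) := by
  rcases eq_or_ne j 0 with rfl | hj
  · have : Subsingleton (B ⧸ RingHom.ker f ^ 0) := by
      rw [pow_zero, Ideal.one_eq_top]; infer_instance
    infer_instance
  let g : (B ⧸ RingHom.ker f ^ j) →ₐ[k] k :=
    Ideal.Quotient.liftₐ _ f fun a ha => Ideal.pow_le_self hj ha
  have hg : RingHom.ker g = (RingHom.ker f).map (Ideal.Quotient.mk (RingHom.ker f ^ j)) := by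
    ext x
    obtain ⟨x, rfl⟩ := Ideal.Quotient.mk_surjective x
    constructor
    · intro h
      exact Ideal.mem_map_of_mem _ h
    · intro h
      have : (RingHom.ker f).map (Ideal.Quotient.mk (RingHom.ker f ^ j)) ≤ RingHom.ker g := by
        rw [Ideal.map_le_iff_le_comap]
        intro y hy
        exact hy
      exact this h
  refine Module.finite_of_surjective_of_ker_le_nilradical g (AlgHom.surjective_of_augmentation g)
    ?_ (hg ▸ hf.map _)
  rw [hg]
  intro x hx
  refine mem_nilradical.mpr ⟨j, ?_⟩
  have := Ideal.pow_mem_pow hx j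
  rwa [← Ideal.map_pow, Ideal.map_quotient_self, Ideal.mem_bot] at this

end Augmented

theorem AlgHom.exists_comp_eq_of_surjective {k P B S : Type*} [CommRing k] [CommRing P]
    [CommRing B] [CommRing S] [Algebra k P] [Algebra k B] [Algebra k S] (β : P →ₐ[k] B)
    (hβ : Function.Surjective β) (c : P →ₐ[k] S) (h : RingHom.ker β ≤ RingHom.ker c) :
    ∃ θ : B →ₐ[k] S, ∀ p, θ (β p) = c p := by
  refine ⟨(Ideal.Quotient.liftₐ (RingHom.ker β) c fun a ha => h ha).comp
    (Ideal.quotientKerAlgEquivOfSurjective hβ).symm.toAlgHom, fun p => ?_⟩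
  have : (Ideal.quotientKerAlgEquivOfSurjective hβ).symm (β p) = Ideal.Quotient.mk _ p := by
    rw [AlgEquiv.symm_apply_eq]; rfl
  exact (congrArg (Ideal.Quotient.liftₐ (RingHom.ker β) c fun a ha => h ha) this).trans rfl

/-! ### Growth of the colength of powers of an ideal -/

section Length

variable {k : Type*} [CommRing k] {B : Type*} [CommRing B] [Algebra k B]

theorem Module.length_le_add_of_exact {k M N P : Type*} [Ring k] [AddCommGroup M] [AddCommGroup N]
    [AddCommGroup P] [Module k M] [Module k N] [Module k P] (h : N →ₗ[k] M) (g : M →ₗ[k] P)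
    (hg : Function.Surjective g) (H : ∀ x, g x = 0 → ∃ y, h y = x) :
    Module.length k M ≤ Module.length k N + Module.length k P := by
  rw [Module.length_eq_add_of_exact (LinearMap.ker g).subtype g (Submodule.subtype_injective _) hg
    (LinearMap.exact_subtype_ker_map g)]
  gcongr
  have h1 : Module.length k (LinearMap.ker g) ≤ Module.length k (LinearMap.range h) :=
    Module.length_le_of_injective (Submodule.inclusion fun x hx => H x hx)
      (Submodule.inclusion_injective _)
  exact h1.trans (Module.length_le_of_surjective h.rangeRestrict h.surjective_rangeRestrict)

-- Multiplication by `x ^ j` gives a right exact sequence `B/(K, x) → B/(K, x^(j+1)) → B/(K, x^j) →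
-- 0`. Its first map need not be injective, whence an inequality only.
variable (k) in
theorem Ideal.length_quotient_sup_span_pow_le (K : Ideal B) (x : B) (j : ℕ) :
    Module.length k (B ⧸ K ⊔ Ideal.span {x ^ j}) ≤
      j * Module.length k (B ⧸ K ⊔ Ideal.span {x}) := by
  induction j with
  | zero =>
    have : Subsingleton (B ⧸ K ⊔ Ideal.span {x ^ 0}) := by
      rw [Ideal.Quotient.subsingleton_iff, pow_zero, Ideal.span_singleton_one, sup_top_eq]
    simp [Module.length_eq_zero]
  | succ j ih =>
    have hle : K ⊔ Ideal.span {x ^ (j + 1)} ≤ K ⊔ Ideal.span {x ^ j} := by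
      refine sup_le_sup_left ?_ _
      rw [Ideal.span_singleton_le_span_singleton]
      exact pow_dvd_pow x (Nat.le_succ j)
    have hmul : K ⊔ Ideal.span {x} ≤
        Submodule.comap (LinearMap.mulLeft B (x ^ j)) (K ⊔ Ideal.span {x ^ (j + 1)}) := by
      refine sup_le (fun y hy => ?_) ?_
      · exact Ideal.mem_sup_left (Ideal.mul_mem_left _ _ hy)
      · rw [Ideal.span_le, Set.singleton_subset_iff]
        refine Ideal.mem_sup_right ?_
        rw [LinearMap.mulLeft_apply, ← pow_succ]
        exact Ideal.mem_span_singleton_self _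
    have := Module.length_le_add_of_exact (k := k)
      (((K ⊔ Ideal.span {x}).mapQ (K ⊔ Ideal.span {x ^ (j + 1)})
        (LinearMap.mulLeft B (x ^ j)) hmul).restrictScalars k)
      ((Submodule.factor hle).restrictScalars k) (Submodule.factor_surjective hle) ?_
    · refine this.trans ?_
      push_cast
      rw [add_mul, one_mul, add_comm]
      gcongr
    · intro z hz
      obtain ⟨z, rfl⟩ := Submodule.mkQ_surjective _ z
      have hz : z ∈ K ⊔ Ideal.span {x ^ j} := (Submodule.Quotient.mk_eq_zero _).mp hz
      obtain ⟨a, ha, b, hb, rfl⟩ := Submodule.mem_sup.mp hz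
      obtain ⟨c, rfl⟩ := Ideal.mem_span_singleton.mp hb
      refine ⟨Submodule.Quotient.mk c, ?_⟩
      refine (Submodule.Quotient.eq _).mpr ?_
      rw [LinearMap.mulLeft_apply, sub_add_cancel_right]
      exact neg_mem (Ideal.mem_sup_left ha)

-- The ideal `K` serves the induction: generators are removed from `s` one at a time and their
-- powers absorbed into `K`.
variable (k) in
theorem Ideal.length_quotient_sup_span_image_pow_le (K : Ideal B) (s : Finset B) (j : ℕ) :
    Module.length k (B ⧸ K ⊔ Ideal.span ((· ^ j) '' (s : Set B))) ≤
      j ^ s.card * Module.length k (B ⧸ K ⊔ Ideal.span (s : Set B)) := by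
  classical
  induction s using Finset.induction_on generalizing K with
  | empty => rw [Finset.coe_empty, Set.image_empty, Finset.card_empty, pow_zero, one_mul]
  | insert x s hx ih =>
    rw [Finset.coe_insert, Set.image_insert_eq, Ideal.span_insert, Ideal.span_insert,
      Finset.card_insert_of_notMem hx, ← sup_assoc, ← sup_assoc]
    refine (ih _).trans ?_
    rw [sup_right_comm K, sup_right_comm K (Ideal.span {x}), pow_succ, mul_assoc]
    refine mul_le_mul' le_rfl ?_
    exact Ideal.length_quotient_sup_span_pow_le k _ x j

variable (k) in
/-- If finitely many elements `x₁, …, x_e` of an ideal `m` span an ideal of finite colength, the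
colength of `m ^ j` grows at most like `j ^ e`. -/
theorem Ideal.length_quotient_pow_le (m : Ideal B) (s : Finset B)
    (hs : Ideal.span (s : Set B) ≤ m) (j : ℕ) :
    Module.length k (B ⧸ m ^ j) ≤ j ^ s.card * Module.length k (B ⧸ Ideal.span (s : Set B)) := by
  have h := Ideal.length_quotient_sup_span_image_pow_le k ⊥ s j
  rw [bot_sup_eq, bot_sup_eq] at h
  refine le_trans ?_ h
  have hle : Ideal.span ((· ^ j) '' (s : Set B)) ≤ m ^ j := by
    rw [Ideal.span_le]
    rintro _ ⟨x, hx, rfl⟩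
    exact Ideal.pow_mem_pow (hs (Ideal.subset_span hx)) j
  exact Module.length_le_of_surjective ((Submodule.factor hle).restrictScalars k)
    (Submodule.factor_surjective hle)

end Length

/-! ### Lifting along surjections of finite-dimensional local algebras -/

/-- A `k`-point `f` of a commutative `k`-algebra `B` has the infinitesimal lifting property if maps
from `B` to finite-dimensional local algebras that are centred at `f` lift along surjections. -/
def AlgHom.HasArtinianLifting {k B : Type u} [Field k] [CommRing B] [Algebra k B]
    (f : B →ₐ[k] k) : Prop :=
  ∀ (S T : Type u) [CommRing S] [IsLocalRing S] [Algebra k S] [Module.Finite k S]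
    [CommRing T] [IsLocalRing T] [Algebra k T] [Module.Finite k T]
    (φ : S →ₐ[k] T) (_ : Function.Surjective φ) (ψ : B →ₐ[k] T),
    (∀ b, f b = 0 → ψ b ∈ maximalIdeal T) → ∃ θ : B →ₐ[k] S, ∀ b, φ (θ b) = ψ b

theorem IsLocalRing.exists_maximalIdeal_pow_eq_bot (k : Type*) [Field k] (S : Type*) [CommRing S]
    [IsLocalRing S] [Algebra k S] [Module.Finite k S] : ∃ j, maximalIdeal S ^ j = ⊥ := by
  have : IsArtinianRing S := IsArtinianRing.of_finite k S
  exact (isArtinianRing_iff_isNilpotent_maximalIdeal S).mp this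

theorem IsLocalRing.mem_maximalIdeal_of_map_mem {S T : Type*} [CommRing S] [IsLocalRing S]
    [CommRing T] [IsLocalRing T] (φ : S →+* T) {x : S} (h : φ x ∈ maximalIdeal T) :
    x ∈ maximalIdeal S := fun hx => h (hx.map φ)

section LocalAlgebra

variable {k L : Type u} [Field k] [CommRing L] [IsLocalRing L] [Algebra k L]

theorem AlgHom.ker_eq_maximalIdeal (f : L →ₐ[k] k) : RingHom.ker f = maximalIdeal L :=
  eq_maximalIdeal f.isMaximal_ker_of_augmentation

/-- The residue field is `k`, so a coefficient `a` in `L` may be replaced by the scalar `f a` at the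
cost of one more power of the maximal ideal. The approximation is then improved order by order. -/
theorem exists_sub_aeval_mem_pow (f : L →ₐ[k] k) {d : ℕ} {y : Fin d → L}
    (hy : Ideal.span (Set.range y) = maximalIdeal L) (j : ℕ) (x : L) :
    ∃ p : MvPolynomial (Fin d) k, x - aeval y p ∈ maximalIdeal L ^ j := by
  have hmap : ∀ j, maximalIdeal L ^ j =
      Ideal.span (aeval (R := k) y '' (idealOfVars (Fin d) k ^ j : Ideal _)) := by
    intro j
    change _ = Ideal.map (aeval (R := k) y) _
    rw [Ideal.map_pow, Ideal.map_span, ← hy, ← Set.range_comp]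
    congr 3
    ext s
    simp
  have step : ∀ j, ∀ x ∈ maximalIdeal L ^ j, ∃ p ∈ idealOfVars (Fin d) k ^ j,
      x - aeval y p ∈ maximalIdeal L ^ (j + 1) := by
    intro j x hx
    rw [hmap] at hx
    induction hx using Submodule.span_induction with
    | mem x hx =>
      obtain ⟨p, hp, rfl⟩ := hx
      exact ⟨p, hp, by simp⟩
    | zero => exact ⟨0, zero_mem _, by simp⟩
    | add x z _ _ hx hz =>
      obtain ⟨p, hp, hx⟩ := hx
      obtain ⟨q, hq, hz⟩ := hz
      exact ⟨p + q, add_mem hp hq, by rw [map_add, add_sub_add_comm]; exact add_mem hx hz⟩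
    | smul a x _ hx =>
      obtain ⟨p, hp, hx⟩ := hx
      refine ⟨C (f a) * p, Ideal.mul_mem_left _ _ hp, ?_⟩
      have h1 : a - algebraMap k L (f a) ∈ maximalIdeal L :=
        f.ker_eq_maximalIdeal ▸ f.sub_algebraMap_mem_ker a
      have h2 := Ideal.mul_mem_mul (aeval_mem_pow_of_mem_pow_idealOfVars hy hp) h1
      rw [← pow_succ] at h2
      have : a • x - aeval y (C (f a) * p) =
          a * (x - aeval y p) + aeval y p * (a - algebraMap k L (f a)) := by
        rw [map_mul, algHom_C, smul_eq_mul]; ring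
      rw [this]
      exact add_mem (Ideal.mul_mem_left _ _ hx) h2
  induction j with
  | zero => exact ⟨0, by simp⟩
  | succ j ih =>
    obtain ⟨p, hp⟩ := ih
    obtain ⟨q, -, hq⟩ := step j _ hp
    exact ⟨p + q, by rwa [map_add, ← sub_sub]⟩

theorem surjective_mk_comp_aeval (f : L →ₐ[k] k) {d : ℕ} {y : Fin d → L}
    (hy : Ideal.span (Set.range y) = maximalIdeal L) (j : ℕ) :
    Function.Surjective ((Ideal.Quotient.mkₐ k (maximalIdeal L ^ j)).comp (aeval y)) := by
  intro z
  obtain ⟨x, rfl⟩ := Ideal.Quotient.mk_surjective z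
  obtain ⟨p, hp⟩ := exists_sub_aeval_mem_pow f hy j x
  exact ⟨p, (Ideal.Quotient.eq.mpr hp).symm⟩

theorem AlgHom.hasArtinianLifting_of_isRegularLocalRing {L : Type u} [CommRing L]
    [IsRegularLocalRing L] [Algebra k L] [Infinite k] (f : L →ₐ[k] k) : f.HasArtinianLifting := by
  intro S T _ _ _ _ _ _ _ _ φ hφ ψ hψ
  obtain ⟨y, hy⟩ := exists_span_range_eq_maximalIdeal L
  -- The nilpotency order of `S` decides where `L` is truncated.
  obtain ⟨j, hj⟩ := exists_maximalIdeal_pow_eq_bot k S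
  have : IsLocalHom (φ : S →+* T) := IsLocalHom.of_surjective _ hφ
  have hψm : ∀ x ∈ maximalIdeal L, ψ x ∈ maximalIdeal T := fun x hx =>
    hψ x (by rwa [← f.ker_eq_maximalIdeal] at hx)
  choose s hs using fun i => hφ (ψ (y i))
  let c : MvPolynomial (Fin (maximalIdeal L).spanFinrank) k →ₐ[k] S := aeval s
  have hsm : ∀ i, c (X i) ∈ maximalIdeal S := by
    intro i
    refine mem_maximalIdeal_of_map_mem (φ : S →+* T) ?_
    rw [aeval_X, RingHom.coe_coe, hs i]
    exact hψm _ (hy ▸ Ideal.subset_span ⟨i, rfl⟩)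
  let β := (Ideal.Quotient.mkₐ k (maximalIdeal L ^ j)).comp
    (aeval (R := k) y)
  obtain ⟨θ, hθ⟩ := β.exists_comp_eq_of_surjective (surjective_mk_comp_aeval f hy j) c <| by
    intro p hp
    have h1 : aeval y p ∈ maximalIdeal L ^ j := Ideal.Quotient.eq_zero_iff_mem.mp hp
    have h2 := mem_pow_idealOfVars_of_aeval_mem hy j (fun i _ s hs hsm =>
      not_pow_maximalIdeal_le_span_of_lt_ringKrullDim (by
        rw [← IsRegularLocalRing.spanFinrank_maximalIdeal]; exact_mod_cast hs) hsm i) h1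
    have h3 := map_pow_idealOfVars_le c hsm j (Ideal.mem_map_of_mem c h2)
    rwa [hj, Ideal.mem_bot] at h3
  refine ⟨θ.comp (Ideal.Quotient.mkₐ k (maximalIdeal L ^ j)), fun x => ?_⟩
  obtain ⟨p, hp⟩ := exists_sub_aeval_mem_pow f hy j x
  have h1 : φ (c p) = ψ (aeval y p) := by
    have : φ.comp c = ψ.comp (aeval y) := by
      ext i
      simp [c, hs i]
    exact DFunLike.congr_fun this p
  -- The polynomial `p` represents `x` only modulo `𝔪^j`, but `ψ` kills `𝔪^j` because it sends `𝔪`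
  -- into the image of the maximal ideal of `S`.
  have h2 : ψ (x - aeval y p) = 0 := by
    have h3 : (maximalIdeal L ^ j).map ψ ≤ (maximalIdeal S ^ j).map φ := by
      rw [Ideal.map_pow, Ideal.map_pow]
      refine Ideal.pow_right_mono ?_ j
      rw [Ideal.map_le_iff_le_comap]
      intro z hz
      obtain ⟨w, hw⟩ := hφ (ψ z)
      rw [Ideal.mem_comap, ← hw]
      refine Ideal.mem_map_of_mem _ (mem_maximalIdeal_of_map_mem (φ : S →+* T) ?_)
      rw [RingHom.coe_coe, hw]
      exact hψm z hz
    have h4 := h3 (Ideal.mem_map_of_mem ψ hp)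
    rwa [hj, Ideal.map_bot, Ideal.mem_bot] at h4
  have h5 : (Ideal.Quotient.mkₐ k (maximalIdeal L ^ j)) x = β p := Ideal.Quotient.eq.mpr hp
  rw [AlgHom.comp_apply, h5, hθ, h1]
  rw [map_sub, sub_eq_zero] at h2
  exact h2.symm

theorem MvPolynomial.ker_aeval_zero_eq (σ k : Type*) [CommRing k] :
    RingHom.ker (aeval (R := k) (fun _ : σ => (0 : k))) = idealOfVars σ k := by
  ext p
  rw [RingHom.mem_ker, ← pow_one (idealOfVars σ k), mem_pow_idealOfVars_iff']
  have : aeval (R := k) (fun _ : σ => (0 : k)) p = coeff 0 p := by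
    rw [← Pi.zero_def, aeval_zero]; rfl
  rw [this]
  constructor
  · intro h x hx
    rw [Nat.lt_one_iff, Finsupp.degree_eq_zero_iff] at hx
    rwa [hx]
  · intro h
    exact h 0 (by simp)

/-- Two maps out of a polynomial ring that agree to second order agree to order `i + 1` on forms of
degree at least `i`. -/
theorem MvPolynomial.sub_mem_pow_of_mem_pow_idealOfVars {σ k S : Type*} [CommRing k] [CommRing S]
    [Algebra k S] (α β : MvPolynomial σ k →ₐ[k] S) (N : Ideal S) (hβ : ∀ s, β (X s) ∈ N)
    (h : ∀ p, α p - β p ∈ N ^ 2) (i : ℕ) {q : MvPolynomial σ k} (hq : q ∈ idealOfVars σ k ^ i) :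
    α q - β q ∈ N ^ (i + 1) := by
  have hα : ∀ s, α (X s) ∈ N := fun s => by
    have := add_mem (Ideal.pow_le_self two_ne_zero (h (X s))) (hβ s)
    rwa [sub_add_cancel] at this
  induction i generalizing q with
  | zero => exact Ideal.pow_le_pow_right (by omega) (h q)
  | succ i ih =>
    rw [pow_succ] at hq
    induction hq using Submodule.mul_induction_on' with
    | mem_mul_mem a ha b hb =>
      have h1 : α b ∈ N := by
        have := map_pow_idealOfVars_le α hα 1 (Ideal.mem_map_of_mem α (by rwa [pow_one]))
        rwa [pow_one] at this
      have h2 : β a ∈ N ^ i := map_pow_idealOfVars_le β hβ i (Ideal.mem_map_of_mem β ha)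
      have h3 := Ideal.mul_mem_mul (ih ha) h1
      have h4 := Ideal.mul_mem_mul h2 (h b)
      rw [← pow_succ] at h3
      rw [← pow_add] at h4
      have : α (a * b) - β (a * b) = (α a - β a) * α b + β a * (α b - β b) := by
        rw [map_mul, map_mul]; ring
      rw [this]
      exact add_mem h3 h4
    | add a _ b _ ha hb =>
      rw [map_add, map_add, add_sub_add_comm]
      exact add_mem ha hb

instance (d j : ℕ) : Module.Finite k (MvPolynomial (Fin d) k ⧸ idealOfVars (Fin d) k ^ j) := by
  have := AlgHom.finite_quotient_ker_pow (aeval (R := k) (fun _ : Fin d => (0 : k)))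
    (IsNoetherian.noetherian _) j
  rwa [ker_aeval_zero_eq] at this

instance (d j : ℕ) : IsLocalRing (MvPolynomial (Fin d) k ⧸ idealOfVars (Fin d) k ^ (j + 1)) := by
  have h := AlgHom.isMaximal_ker_of_augmentation (aeval (R := k) (fun _ : Fin d => (0 : k)))
  rw [ker_aeval_zero_eq] at h
  exact Ideal.isLocalRing_quotient_pow _ (Nat.succ_ne_zero j)

/-- Orders up to two hold for any minimal generators. Beyond that, the map `L → k[t]/(t)²` is lifted
to a higher truncation; the composite from `k[t]` agrees with the quotient map to second order,
hence preserves leading forms. -/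
theorem AlgHom.HasArtinianLifting.mem_pow_idealOfVars [IsNoetherianRing L] [Infinite k]
    {f : L →ₐ[k] k} (hf : f.HasArtinianLifting) {d : ℕ} (hd : d ≤ (maximalIdeal L).spanFinrank)
    {y : Fin d → L} (hy : Ideal.span (Set.range y) = maximalIdeal L) (j : ℕ)
    {p : MvPolynomial (Fin d) k} (hp : aeval y p ∈ maximalIdeal L ^ j) :
    p ∈ idealOfVars (Fin d) k ^ j := by
  have hsmall : ∀ j ≤ 2, ∀ p : MvPolynomial (Fin d) k, aeval y p ∈ maximalIdeal L ^ j →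
      p ∈ idealOfVars (Fin d) k ^ j := fun j hj2 p hp =>
    mem_pow_idealOfVars_of_aeval_mem hy j (fun i hi s hs hsm =>
      not_pow_maximalIdeal_le_span_of_lt_spanFinrank (hs.trans_le hd) hsm (by omega)) hp
  rcases le_or_gt j 2 with hj2 | hj2
  · exact hsmall j hj2 p hp
  obtain ⟨j, rfl⟩ : ∃ i, j = i + 1 := ⟨j - 1, by omega⟩
  set n := idealOfVars (Fin d) k
  -- The exponent is written `1 + 1` to fit the `IsLocalRing` instance for successor exponents.
  have hle : n ^ (j + 1) ≤ n ^ (1 + 1) := Ideal.pow_le_pow_right (by omega)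
  let φ : (MvPolynomial (Fin d) k ⧸ n ^ (j + 1)) →ₐ[k] (MvPolynomial (Fin d) k ⧸ n ^ (1 + 1)) :=
    Ideal.Quotient.factorₐ k hle
  have hφ : Function.Surjective φ := Ideal.Quotient.factor_surjective hle
  obtain ⟨ψ, hψ⟩ := AlgHom.exists_comp_eq_of_surjective _ (surjective_mk_comp_aeval f hy 2)
    (Ideal.Quotient.mkₐ k (n ^ (1 + 1))) <| by
      intro p hp
      exact Ideal.Quotient.eq_zero_iff_mem.mpr
        (hsmall 2 le_rfl p (Ideal.Quotient.eq_zero_iff_mem.mp hp))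
  obtain ⟨θ, hθ⟩ := hf _ _ φ hφ (ψ.comp (Ideal.Quotient.mkₐ k _)) <| by
    intro b hb hu
    have hb : b ∈ maximalIdeal L := by rwa [← f.ker_eq_maximalIdeal]
    have h0 : (Ideal.Quotient.mkₐ k (maximalIdeal L ^ 2)) (b ^ 2) = 0 :=
      Ideal.Quotient.eq_zero_iff_mem.mpr (Ideal.pow_mem_pow hb 2)
    have h1 := hu.pow 2
    rw [← map_pow, AlgHom.comp_apply, h0, map_zero] at h1
    exact not_isUnit_zero h1
  let β := Ideal.Quotient.mkₐ k (n ^ (j + 1))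
  let α := θ.comp (aeval (R := k) y)
  let N := n.map β
  have hβ : ∀ s, β (X s) ∈ N := fun s => Ideal.mem_map_of_mem _ (Ideal.subset_span ⟨s, rfl⟩)
  have hαβ : ∀ p, α p - β p ∈ N ^ 2 := by
    intro p
    have h1 : φ (α p - β p) = 0 := by
      rw [map_sub, sub_eq_zero, AlgHom.comp_apply, hθ]
      exact hψ p
    obtain ⟨q, hq⟩ := Ideal.Quotient.mk_surjective (α p - β p)
    rw [← hq] at h1 ⊢
    rw [← Ideal.map_pow]
    exact Ideal.mem_map_of_mem β (Ideal.Quotient.eq_zero_iff_mem.mp h1)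
  have hN : N ^ (j + 1) = ⊥ := by
    rw [← Ideal.map_pow]
    exact Ideal.map_quotient_self _
  have hαp : α p = 0 := by
    have h1 : (maximalIdeal L).map θ ≤ N := by
      rw [← hy, Ideal.map_span, Ideal.span_le]
      rintro _ ⟨_, ⟨s, rfl⟩, rfl⟩
      have h2 := add_mem (Ideal.pow_le_self two_ne_zero (hαβ (X s))) (hβ s)
      rwa [sub_add_cancel, AlgHom.comp_apply, aeval_X] at h2
    have h2 := Ideal.pow_right_mono h1 (j + 1)
    rw [← Ideal.map_pow, hN] at h2
    exact h2 (Ideal.mem_map_of_mem θ hp)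
  -- Since `α p = 0`, order `i` for `p` forces `β p` into `N^(i+1)`, which lifts back to order `i +
  -- 1` as long as `i < j + 1`.
  have key : ∀ i ≤ j + 1, p ∈ n ^ i := by
    intro i
    induction i with
    | zero => intro _; simp
    | succ i ih =>
      intro hi
      have h1 := sub_mem_pow_of_mem_pow_idealOfVars α β N hβ hαβ i (ih (by omega))
      rw [hαp, zero_sub, neg_mem_iff, ← Ideal.map_pow] at h1
      obtain ⟨q, hq, hqp⟩ := (Ideal.mem_map_iff_of_surjective β Ideal.Quotient.mk_surjective).mp h1
      have h2 : p - q ∈ n ^ (j + 1) := Ideal.Quotient.eq.mp hqp.symm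
      rw [← sub_add_cancel p q]
      exact add_mem (Ideal.pow_le_pow_right hi h2) hq
  exact key (j + 1) le_rfl

end LocalAlgebra

/-! ### Dimension from the growth of truncations -/

section LocalAlgebra

variable {k L : Type u} [Field k] [CommRing L] [IsLocalRing L] [IsNoetherianRing L] [Algebra k L]

/-- The `i^d` monomials with all exponents below `i` have degree less than `d * i`, so they stay
independent in the quotient. For `d = 0` the quotient is zero and the bound fails. -/
theorem pow_le_length_quotient_maximalIdeal_pow (f : L →ₐ[k] k) {d : ℕ} (hd : d ≠ 0)
    {y : Fin d → L} (h : ∀ (j : ℕ) (p : MvPolynomial (Fin d) k),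
      aeval y p ∈ maximalIdeal L ^ j → p ∈ idealOfVars (Fin d) k ^ j) (i : ℕ) :
    ((i ^ d : ℕ) : ℕ∞) ≤ Module.length k (L ⧸ maximalIdeal L ^ (d * i)) := by
  have : Module.Finite k (L ⧸ maximalIdeal L ^ (d * i)) := by
    have := f.finite_quotient_ker_pow (IsNoetherian.noetherian _) (d * i)
    rwa [f.ker_eq_maximalIdeal] at this
  let e : (Fin d → Fin i) → (Fin d →₀ ℕ) := fun x => Finsupp.equivFunOnFinite.symm fun s => x s
  have he : Function.Injective e := fun x x' hx => by
    have := Finsupp.equivFunOnFinite.symm.injective hx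
    ext s
    exact congrFun this s
  have hdeg : ∀ x, (e x).degree < d * i := by
    intro x
    have : Nonempty (Fin d) := ⟨⟨0, Nat.pos_of_ne_zero hd⟩⟩
    rw [Finsupp.degree_eq_sum]
    calc ∑ s, e x s < ∑ _s : Fin d, i :=
          Finset.sum_lt_sum_of_nonempty Finset.univ_nonempty fun s _ => (x s).2
      _ = d * i := by simp
  have hli : LinearIndependent k fun x : Fin d → Fin i =>
      (Ideal.Quotient.mkₐ k (maximalIdeal L ^ (d * i))) (aeval y (monomial (e x) (1 : k))) := by
    rw [Fintype.linearIndependent_iff]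
    intro c hc x
    have h1 : (Ideal.Quotient.mkₐ k (maximalIdeal L ^ (d * i)))
        (aeval y (∑ x, monomial (e x) (c x))) = 0 := by
      rw [← hc, map_sum, map_sum]
      refine Finset.sum_congr rfl fun x _ => ?_
      rw [← map_smul, ← map_smul, smul_monomial, smul_eq_mul, mul_one]
    have h2 := (mem_pow_idealOfVars_iff' _ _).mp (h _ _ (Ideal.Quotient.eq_zero_iff_mem.mp h1))
      (e x) (hdeg x)
    classical
    rw [coeff_sum, Finset.sum_eq_single x] at h2
    · rwa [coeff_monomial, if_pos rfl] at h2
    · intro x' _ hx'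
      rw [coeff_monomial, if_neg fun h => hx' (he h)]
    · simp
  have := hli.fintype_card_le_finrank
  rw [Module.length_eq_finrank]
  exact_mod_cast by simpa using this

/-- A system of parameters `s` has `dim L` elements and finite colength. If `s.card < d`, the lower
bound `i^d` outgrows the upper bound `(d * i)^s.card * C`. -/
theorem le_ringKrullDim_of_mem_pow_idealOfVars (f : L →ₐ[k] k) {d : ℕ}
    {y : Fin d → L} (h : ∀ (j : ℕ) (p : MvPolynomial (Fin d) k),
      aeval y p ∈ maximalIdeal L ^ j → p ∈ idealOfVars (Fin d) k ^ j) :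
    (d : WithBot ℕ∞) ≤ ringKrullDim L := by
  obtain ⟨s, hs, hcard⟩ := (maximalIdeal L).exists_finset_card_eq_height_of_isNoetherianRing
  rw [← maximalIdeal_height_eq_ringKrullDim, ← hcard]
  by_contra! hlt
  have hlt : s.card < d := by exact_mod_cast hlt
  have hsm : Ideal.span (s : Set L) ≤ maximalIdeal L := hs.1.2
  have hfin : Module.Finite k (L ⧸ Ideal.span (s : Set L)) := by
    obtain ⟨c, hc⟩ := Ideal.exists_radical_pow_le_of_fg (Ideal.span (s : Set L))
      (IsNoetherian.noetherian _)
    have hrad : maximalIdeal L ≤ (Ideal.span (s : Set L)).radical := by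
      rw [Ideal.radical_eq_sInf]
      refine le_sInf ?_
      rintro P ⟨hP, hP'⟩
      exact hs.2 ⟨hP', hP⟩ (le_maximalIdeal hP'.ne_top)
    have hle := (Ideal.pow_right_mono hrad c).trans hc
    have := f.finite_quotient_ker_pow (IsNoetherian.noetherian _) c
    rw [f.ker_eq_maximalIdeal] at this
    exact Module.Finite.of_surjective ((Submodule.factor hle).restrictScalars k)
      (Submodule.factor_surjective hle)
  set C := Module.finrank k (L ⧸ Ideal.span (s : Set L))
  have hbound : ∀ i : ℕ, i ^ d ≤ (d * i) ^ s.card * C := by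
    intro i
    have h1 := (pow_le_length_quotient_maximalIdeal_pow f (by omega) h i).trans
      (Ideal.length_quotient_pow_le k (maximalIdeal L) s hsm (d * i))
    rw [Module.length_eq_finrank] at h1
    exact_mod_cast h1
  -- After cancelling `i ^ s.card` the bound reads `i ≤ d ^ s.card * C`, which this `i` just
  -- violates.
  have h1 := hbound (d ^ s.card * C + 1)
  set i := d ^ s.card * C + 1
  have h2 : i ^ (s.card + 1) ≤ i ^ d := Nat.pow_le_pow_right (by omega) hlt
  have h3 : i * i ^ s.card ≤ (d ^ s.card * C) * i ^ s.card := by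
    calc i * i ^ s.card = i ^ (s.card + 1) := by ring
      _ ≤ (d * i) ^ s.card * C := h2.trans h1
      _ = (d ^ s.card * C) * i ^ s.card := by rw [mul_pow]; ring
  have h4 := Nat.le_of_mul_le_mul_right h3 (pow_pos (by omega) _)
  omega

theorem AlgHom.HasArtinianLifting.isRegularLocalRing [Infinite k] {f : L →ₐ[k] k}
    (hf : f.HasArtinianLifting) : IsRegularLocalRing L := by
  obtain ⟨y, hy⟩ := exists_span_range_eq_maximalIdeal L
  exact .of_spanFinrank_maximalIdeal_le _ (le_ringKrullDim_of_mem_pow_idealOfVars f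
    fun j p hp => hf.mem_pow_idealOfVars le_rfl hy j hp)

end LocalAlgebra

/-! ### Passing to the local ring at the point -/

section Localization

variable {k B : Type u} [Field k] [CommRing B] [Algebra k B] (f : B →ₐ[k] k)
  (P : Ideal B) [P.IsPrime] (hP : RingHom.ker f = P)

theorem exists_algHom_localizationAtPrime {C : Type*} [CommRing C] [IsLocalRing C]
    [Algebra k C] (ψ : B →ₐ[k] C) (hψ : ∀ b, b ∉ P → ψ b ∉ maximalIdeal C) :
    ∃ θ : Localization.AtPrime P →ₐ[k] C,
      ∀ b, θ (algebraMap B (Localization.AtPrime P) b) = ψ b := by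
  have hu : ∀ b : P.primeCompl, IsUnit (ψ b) := fun b => by
    have := hψ b b.2
    rwa [mem_maximalIdeal, mem_nonunits_iff, not_not] at this
  exact ⟨IsLocalization.liftAlgHom hu, fun b => by
    rw [IsLocalization.liftAlgHom_apply]; exact IsLocalization.lift_eq _ b⟩

include hP in
theorem exists_algHom_localizationAtPrime_comp_eq :
    ∃ g : Localization.AtPrime P →ₐ[k] k,
      ∀ b, g (algebraMap B (Localization.AtPrime P) b) = f b := by
  refine exists_algHom_localizationAtPrime P f fun b hb h => hb ?_
  rw [← hP, RingHom.mem_ker]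
  by_contra hne
  exact h (IsUnit.mk0 _ hne)

theorem AlgHom.localization_comp_eq_iff {C : Type*} [CommRing C] [Algebra k C]
    {α β : Localization.AtPrime P →ₐ[k] C} :
    (∀ x, α x = β x) ↔ ∀ b, α (algebraMap B (Localization.AtPrime P) b) =
      β (algebraMap B (Localization.AtPrime P) b) := by
  refine ⟨fun h b => h _, fun h => ?_⟩
  have : (α : Localization.AtPrime P →+* C) = β :=
    IsLocalization.ringHom_ext P.primeCompl (RingHom.ext h)
  exact fun x => congrArg (fun g : Localization.AtPrime P →+* C => g x) this

theorem AlgHom.notMem_maximalIdeal_of_ne_zero {C : Type*} [CommRing C] [IsLocalRing C]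
    [Algebra k C] {ψ : B →ₐ[k] C} (hψ : ∀ b, f b = 0 → ψ b ∈ maximalIdeal C) {b : B}
    (hb : f b ≠ 0) : ψ b ∉ maximalIdeal C := by
  intro h
  have h1 := hψ (b - algebraMap k B (f b)) (f.sub_algebraMap_mem_ker b)
  rw [map_sub, ψ.commutes, Submodule.sub_mem_iff_right _ h] at h1
  exact h1 ((IsUnit.mk0 _ hb).map (algebraMap k C))

-- A map to a local algebra centred at `f` sends everything outside `P` to units, so it extends to
-- the localization; both rings thus pose the same lifting problems.
include hP in
theorem AlgHom.hasArtinianLifting_localization_iff (g : Localization.AtPrime P →ₐ[k] k)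
    (hg : ∀ b, g (algebraMap B (Localization.AtPrime P) b) = f b) :
    g.HasArtinianLifting ↔ f.HasArtinianLifting := by
  have hmem : ∀ b, b ∉ P → f b ≠ 0 := fun b hb h => hb (hP ▸ h)
  constructor
  · intro H S T _ _ _ _ _ _ _ _ φ hφ ψ hψ
    obtain ⟨ψ', hψ'⟩ := exists_algHom_localizationAtPrime P ψ fun b hb =>
      f.notMem_maximalIdeal_of_ne_zero hψ (hmem b hb)
    obtain ⟨θ, hθ⟩ := H S T φ hφ ψ' fun x hx => by
      intro hu
      have hx : x ∈ maximalIdeal (Localization.AtPrime P) := fun h => by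
        have := h.map g
        rw [hx] at this
        exact not_isUnit_zero this
      obtain ⟨b, c, rfl⟩ := IsLocalization.exists_mk'_eq P.primeCompl x
      rw [IsLocalization.AtPrime.mk'_mem_maximal_iff (Localization.AtPrime P) P] at hx
      have h1 : ψ' (algebraMap B _ b) ∈ maximalIdeal T := by
        rw [hψ']
        exact hψ b (by rw [← hP] at hx; exact hx)
      rw [← IsLocalization.mk'_spec (Localization.AtPrime P) b c, map_mul] at h1
      refine h1 (hu.mul ?_)
      exact (IsLocalization.map_units (Localization.AtPrime P) c).map ψ'
    exact ⟨θ.comp (IsScalarTower.toAlgHom k B (Localization.AtPrime P)), fun b => by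
      rw [← hψ']; exact hθ _⟩
  · intro H S T _ _ _ _ _ _ _ _ φ hφ ψ hψ
    have hψ' : ∀ b, f b = 0 → ψ (algebraMap B _ b) ∈ maximalIdeal T := fun b hb =>
      hψ _ (by rw [hg, hb])
    obtain ⟨θ, hθ⟩ := H S T φ hφ (ψ.comp (IsScalarTower.toAlgHom k B (Localization.AtPrime P))) hψ'
    obtain ⟨θ', hθ'⟩ := exists_algHom_localizationAtPrime P θ fun b hb =>
      f.notMem_maximalIdeal_of_ne_zero (fun b hb =>
        mem_maximalIdeal_of_map_mem (φ : S →+* T) (by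
          rw [RingHom.coe_coe, hθ]; exact hψ' b hb)) (hmem b hb)
    refine ⟨θ', (AlgHom.localization_comp_eq_iff P (α := φ.comp θ') (β := ψ)).mpr fun b => ?_⟩
    rw [AlgHom.comp_apply, hθ', hθ]
    rfl

end Localization

theorem RepScheme.isRegularPoint_iff_hasArtinianLifting {k B : Type u} [Field k] [Infinite k]
    [CommRing B] [IsNoetherianRing B] [Algebra k B] (f : B →ₐ[k] k) :
    IsRegularPoint (underlyingPoint f) ↔ f.HasArtinianLifting := by
  obtain ⟨g, hg⟩ := exists_algHom_localizationAtPrime_comp_eq f (underlyingPoint f).asIdeal rfl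
  rw [← f.hasArtinianLifting_localization_iff (underlyingPoint f).asIdeal rfl g hg]
  have : IsNoetherianRing (Localization.AtPrime (underlyingPoint f).asIdeal) :=
    IsLocalization.isNoetherianRing (underlyingPoint f).asIdeal.primeCompl _ inferInstance
  exact ⟨fun h => @AlgHom.hasArtinianLifting_of_isRegularLocalRing _ _ _ _ h _ _ g,
    fun h => h.isRegularLocalRing⟩

/-! ### Harrison cohomology in terms of bilinear forms -/

namespace RepScheme

section

open scoped TensorProduct

theorem harr2_eq_bot_iff (k B M : Type*) [Field k] [CommRing B] [Algebra k B]
    [AddCommGroup M] [Module k M] [Module B M] [IsScalarTower k B M] :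
    Harr2 k B M = ⊥ ↔ symmetricCocycles₂ k B M ≤ coboundaries₂ k B M := by
  rw [Harr2, ← LinearMap.le_ker_iff_map, Submodule.ker_mkQ]

theorem harr2_pointModule_eq_bot_iff {k B : Type u} [Field k] [CommRing B] [Algebra k B]
    (f : B →ₐ[k] k) :
    Harr2 k B (PointModule f) = ⊥ ↔ ∀ ω : B →ₗ[k] B →ₗ[k] k,
      (∀ a b c, f a * ω b c - ω (a * b) c + ω a (b * c) - f c * ω a b = 0) →
      (∀ a b, ω a b = ω b a) →
      ∃ g : B →ₗ[k] k, ∀ a b, ω a b = f a * g b - g (a * b) + f b * g a := by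
  rw [harr2_eq_bot_iff]
  constructor
  · intro H ω hω hsymm
    let ω' : B ⊗[k] B →ₗ[k] PointModule f := TensorProduct.lift ω
    have hω' : ω' ∈ cocycles₂ k B (PointModule f) := hω
    exact H (show (⟨ω', hω'⟩ : cocycles₂ k B (PointModule f)) ∈ symmetricCocycles₂ k B _ from hsymm)
  · intro H ω hsymm
    let ω' : B ⊗[k] B →ₗ[k] k := ω.1
    exact H (TensorProduct.curry ω') ω.2 hsymm

end

end RepScheme

/-! ### Lifting along small extensions -/

section SmallExtension

variable {k : Type u} [Field k]

theorem IsLocalRing.exists_sub_algebraMap_mem_maximalIdeal [IsAlgClosed k] {S : Type*} [CommRing S]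
    [IsLocalRing S] [Algebra k S] [Module.Finite k S] (s : S) :
    ∃ c : k, s - algebraMap k S c ∈ maximalIdeal S := by
  have : Algebra.IsIntegral k (ResidueField S) := inferInstance
  obtain ⟨c, hc⟩ := (IsAlgClosed.algebraMap_bijective_of_isIntegral
    (k := k) (K := ResidueField S)).2 (residue S s)
  refine ⟨c, ?_⟩
  rw [← residue_eq_zero_iff, map_sub, ← hc, sub_eq_zero]
  rfl

/-- Any nonzero element of the last nonzero product `𝔪^i * I` will do. -/
theorem IsLocalRing.exists_mem_ne_zero_forall_mul_eq_zero (k : Type*) [Field k] {S : Type*}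
    [CommRing S] [IsLocalRing S] [Algebra k S] [Module.Finite k S] {I : Ideal S} (hI : I ≠ ⊥) :
    ∃ x ∈ I, x ≠ 0 ∧ ∀ s ∈ maximalIdeal S, s * x = 0 := by
  obtain ⟨i, hne, hi⟩ : ∃ i, maximalIdeal S ^ i * I ≠ ⊥ ∧ maximalIdeal S ^ (i + 1) * I = ⊥ := by
    by_contra! hc
    obtain ⟨j, hj⟩ := exists_maximalIdeal_pow_eq_bot k S
    have hall : ∀ i, maximalIdeal S ^ i * I ≠ ⊥ := fun i => by
      induction i with
      | zero => rwa [pow_zero, Ideal.one_eq_top, Ideal.top_mul]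
      | succ i ih => exact hc i ih
    exact hall j (by rw [hj, Ideal.bot_mul])
  obtain ⟨x, hx, hx0⟩ := Submodule.exists_mem_ne_zero_of_ne_bot hne
  refine ⟨x, Ideal.mul_le_right hx, hx0, fun s hs => ?_⟩
  have h1 := Ideal.mul_mem_mul hs hx
  rw [← mul_assoc, ← pow_succ', hi, Ideal.mem_bot] at h1
  exact h1

variable {B : Type u} [CommRing B] [Algebra k B]

/-- If symmetric `2`-cocycles are coboundaries, maps lift along surjections whose kernel is a line
killed by the maximal ideal. -/
theorem AlgHom.exists_lift_of_small_extension [IsAlgClosed k] (f : B →ₐ[k] k)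
    (H : ∀ ω : B →ₗ[k] B →ₗ[k] k,
      (∀ a b c, f a * ω b c - ω (a * b) c + ω a (b * c) - f c * ω a b = 0) →
      (∀ a b, ω a b = ω b a) →
      ∃ g : B →ₗ[k] k, ∀ a b, ω a b = f a * g b - g (a * b) + f b * g a)
    {S T : Type u} [CommRing S] [IsLocalRing S] [Algebra k S] [Module.Finite k S]
    [CommRing T] [IsLocalRing T] [Algebra k T] (φ : S →ₐ[k] T) (hφ : Function.Surjective φ)
    {x : S} (hx0 : x ≠ 0) (hxm : ∀ s ∈ maximalIdeal S, s * x = 0)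
    (hker : RingHom.ker φ = Ideal.span {x}) (ψ : B →ₐ[k] T)
    (hψ : ∀ b, f b = 0 → ψ b ∈ maximalIdeal T) : ∃ θ : B →ₐ[k] S, ∀ b, φ (θ b) = ψ b := by
  obtain ⟨s, hs⟩ := φ.toLinearMap.exists_rightInverse_of_surjective
    (LinearMap.range_eq_top.mpr hφ)
  let σ : B →ₗ[k] S := s ∘ₗ ψ.toLinearMap
  have hσ : ∀ b, φ (σ b) = ψ b := fun b => LinearMap.congr_fun hs (ψ b)
  obtain ⟨l, hl⟩ : ∃ l : S →ₗ[k] k, l x = 1 := by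
    obtain ⟨l, hl⟩ := not_forall.mp (mt (Module.forall_dual_apply_eq_zero_iff k x).mp hx0)
    exact ⟨(l x)⁻¹ • l, by simp [hl]⟩
  have hφx : φ x = 0 := by
    rw [← RingHom.mem_ker, hker]; exact Ideal.mem_span_singleton_self x
  have hkerl : ∀ z, φ z = 0 → z = algebraMap k S (l z) * x := by
    intro z hz
    rw [← RingHom.mem_ker, hker] at hz
    obtain ⟨c, rfl⟩ := Ideal.mem_span_singleton'.mp hz
    obtain ⟨r, hr⟩ := exists_sub_algebraMap_mem_maximalIdeal (k := k) c
    have h1 := hxm _ hr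
    rw [sub_mul, sub_eq_zero] at h1
    rw [h1, ← Algebra.smul_def, map_smul, hl, smul_eq_mul, mul_one, Algebra.smul_def]
  -- On the kernel `σ a` acts through `f a`; this turns associativity in `S` into the cocycle
  -- identity over `f`.
  have hσker : ∀ a z, φ z = 0 → σ a * z = algebraMap k S (f a) * z := by
    intro a z hz
    have h1 : σ a - algebraMap k S (f a) ∈ maximalIdeal S := by
      refine mem_maximalIdeal_of_map_mem (φ : S →+* T) ?_
      rw [RingHom.coe_coe, map_sub, hσ, φ.commutes, ← ψ.commutes, ← map_sub]
      exact hψ _ (f.sub_algebraMap_mem_ker a)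
    rw [← sub_eq_zero, ← sub_mul, hkerl z hz, mul_left_comm, hxm _ h1, mul_zero]
  have hx2 : x * x = 0 := hxm x fun hu => by
    have := hu.map φ
    rw [hφx] at this
    exact not_isUnit_zero this
  -- The failure of the linear lift `σ` to be multiplicative. It takes values in the line spanned by
  -- `x`, whose coordinate is `l`.
  let D : B →ₗ[k] B →ₗ[k] S :=
    (LinearMap.mul k S).compl₁₂ σ σ - (LinearMap.mul k B).compr₂ σ
  have hD : ∀ a b, D a b = σ a * σ b - σ (a * b) := fun a b => rfl
  have hDφ : ∀ a b, φ (D a b) = 0 := fun a b => by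
    rw [hD, map_sub, map_mul, hσ, hσ, hσ, map_mul, sub_self]
  have hlin : ∀ (r : k) z, r * l z = l (algebraMap k S r * z) := fun r z => by
    rw [← Algebra.smul_def, map_smul, smul_eq_mul]
  obtain ⟨g, hg⟩ := H (D.compr₂ l)
    (fun a b c => by
      simp only [LinearMap.compr₂_apply, hlin]
      rw [← hσker a _ (hDφ b c), ← hσker c _ (hDφ a b), ← map_sub, ← map_add, ← map_sub,
        ← map_zero l]
      congr 1
      rw [hD, hD, hD, hD, ← mul_assoc a b c]
      ring)
    (fun a b => by
      rw [LinearMap.compr₂_apply, LinearMap.compr₂_apply, hD, hD, mul_comm, mul_comm a b])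
  let h : B →ₗ[k] S := σ - (LinearMap.toSpanSingleton k S x) ∘ₗ g
  have hh : ∀ b, h b = σ b - algebraMap k S (g b) * x := fun b => by
    simp [h, Algebra.smul_def]
  have hhφ : ∀ b, φ (h b) = ψ b := fun b => by
    rw [hh, map_sub, map_mul, hφx, mul_zero, sub_zero, hσ]
  have hmul : ∀ a b, h (a * b) = h a * h b := by
    intro a b
    have h1 := hkerl _ (hDφ a b)
    have h2 : l (D a b) = _ := hg a b
    rw [h2, hD] at h1
    have h3 := hσker a x hφx
    have h4 := hσker b x hφx
    simp only [map_add, map_sub, map_mul] at h1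
    rw [hh, hh, hh]
    linear_combination -h1 + algebraMap k S (g b) * h3 + algebraMap k S (g a) * h4 -
      algebraMap k S (g a) * algebraMap k S (g b) * hx2
  -- `h 1` is idempotent, and a unit because it lies over `1`.
  have hone : h 1 = 1 := by
    have h1 : IsUnit (h 1) := by
      by_contra hu
      have : IsLocalHom (φ : S →+* T) := IsLocalHom.of_surjective _ hφ
      refine hu (isUnit_of_map_unit (φ : S →+* T) _ ?_)
      rw [RingHom.coe_coe, hhφ, map_one]
      exact isUnit_one
    have h2 := hmul 1 1
    rw [mul_one] at h2
    exact (h1.mul_eq_left.mp h2.symm)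
  exact ⟨AlgHom.ofLinearMap h hone hmul, hhφ⟩

/-- Induction on `dim S`: a line in `ker φ` killed by the maximal ideal is divided out, the map is
lifted to the smaller quotient, then across the small extension. -/
theorem RepScheme.hasArtinianLifting_of_harr2_eq_bot [IsAlgClosed k] (f : B →ₐ[k] k)
    (H : Harr2 k B (PointModule f) = ⊥) : f.HasArtinianLifting := by
  rw [harr2_pointModule_eq_bot_iff] at H
  intro S T _ _ _ _ _ _ _ _ φ hφ ψ hψ
  induction hn : Module.finrank k S using Nat.strong_induction_on generalizing S with
  | _ n ih =>
  subst hn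
  by_cases hbot : RingHom.ker φ = ⊥
  · have hinj : Function.Injective φ := (RingHom.injective_iff_ker_eq_bot _).mpr hbot
    let e := AlgEquiv.ofBijective φ ⟨hinj, hφ⟩
    exact ⟨(e.symm : T →ₐ[k] S).comp ψ, fun b => e.apply_symm_apply (ψ b)⟩
  obtain ⟨x, hx, hx0, hxm⟩ := exists_mem_ne_zero_forall_mul_eq_zero k hbot
  let S' := S ⧸ Ideal.span {x}
  have hle : Ideal.span {x} ≤ RingHom.ker φ := (Ideal.span_singleton_le_iff_mem _).mpr hx
  have : Nontrivial S' := Ideal.Quotient.nontrivial_iff.mpr fun htop =>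
    RingHom.ker_ne_top φ (top_le_iff.mp (htop ▸ hle))
  have : IsLocalRing S' := IsLocalRing.of_surjective' _ Ideal.Quotient.mk_surjective
  let q : S →ₐ[k] S' := Ideal.Quotient.mkₐ k _
  let φ' : S' →ₐ[k] T := Ideal.Quotient.liftₐ _ φ fun a ha => hle ha
  have hφ' : Function.Surjective φ' := Ideal.Quotient.lift_surjective_of_surjective _ _ hφ
  have hlt : Module.finrank k S' < Module.finrank k S := by
    have h1 := Submodule.finrank_quotient_add_finrank ((Ideal.span {x}).restrictScalars k)
    have h2 : 0 < Module.finrank k ((Ideal.span {x}).restrictScalars k) := by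
      rw [Module.finrank_pos_iff, Submodule.nontrivial_iff_ne_bot]
      refine Submodule.ne_bot_iff _ |>.mpr ⟨x, Ideal.mem_span_singleton_self x, hx0⟩
    have h3 : Module.finrank k S' =
      Module.finrank k (S ⧸ (Ideal.span {x}).restrictScalars k) := rfl
    omega
  obtain ⟨θ', hθ'⟩ := ih _ hlt S' φ' hφ' rfl
  obtain ⟨θ, hθ⟩ := f.exists_lift_of_small_extension H q Ideal.Quotient.mk_surjective hx0 hxm
    Ideal.mk_ker θ' fun b hb => mem_maximalIdeal_of_map_mem (φ' : S' →+* T) (by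
      rw [RingHom.coe_coe, hθ']; exact hψ b hb)
  exact ⟨θ, fun b => by rw [← hθ', ← hθ]; rfl⟩

end SmallExtension

/-! ### The square-zero extension defined by a symmetric cocycle -/

theorem AlgHom.isNoetherianRing_of_finite_ker {k E B : Type*} [Field k] [CommRing E] [CommRing B]
    [Algebra k E] [Algebra k B] [IsNoetherianRing B] (pr : E →ₐ[k] B)
    (hpr : Function.Surjective pr) [Module.Finite k (RingHom.ker pr)] : IsNoetherianRing E := by
  let _ : Module E B := Module.compHom B (pr : E →+* B)
  have : RingHomSurjective (pr : E →+* B) := ⟨hpr⟩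
  let l : B →ₛₗ[(pr : E →+* B)] B := { toFun := id, map_add' := fun _ _ => rfl,
                                       map_smul' := fun _ _ => rfl }
  have : IsNoetherian E B := (l.isNoetherian_iff_of_bijective Function.bijective_id).mpr ‹_›
  have : IsNoetherian E (RingHom.ker pr) := isNoetherian_of_tower k inferInstance
  let g : E →ₗ[E] B := { toFun := pr, map_add' := map_add pr, map_smul' := map_mul pr }
  refine isNoetherian_of_range_eq_ker (RingHom.ker pr).subtype g ?_
  rw [Submodule.range_subtype]
  rfl

/-- Symmetric Hochschild `2`-cocycles with values in `k`, regarded as a module via `f`. -/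
structure AlgHom.IsSymmetricCocycle {k B : Type u} [Field k] [CommRing B] [Algebra k B]
    (f : B →ₐ[k] k) (ω : B →ₗ[k] B →ₗ[k] k) : Prop where
  cocycle : ∀ a b c, f a * ω b c - ω (a * b) c + ω a (b * c) - f c * ω a b = 0
  symm : ∀ a b, ω a b = ω b a

/-- The square-zero extension of `B` by `k` defined by a symmetric `2`-cocycle. -/
@[ext]
structure CocycleExtension {k B : Type u} [Field k] [CommRing B] [Algebra k B]
    {f : B →ₐ[k] k} {ω : B →ₗ[k] B →ₗ[k] k} (hω : f.IsSymmetricCocycle ω) : Type u where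
  base : B
  fiber : k

namespace CocycleExtension

variable {k B : Type u} [Field k] [CommRing B] [Algebra k B] {f : B →ₐ[k] k}
  {ω : B →ₗ[k] B →ₗ[k] k} (hω : f.IsSymmetricCocycle ω)

/-- The underlying vector space of the extension is `B × k`. -/
def equivProd : CocycleExtension hω ≃ B × k where
  toFun x := (x.base, x.fiber)
  invFun x := ⟨x.1, x.2⟩

noncomputable instance : AddCommGroup (CocycleExtension hω) := (equivProd hω).addCommGroup

noncomputable instance : Module k (CocycleExtension hω) := (equivProd hω).module k

instance : Mul (CocycleExtension hω) :=
  ⟨fun x y => ⟨x.base * y.base, f x.base * y.fiber + f y.base * x.fiber + ω x.base y.base⟩⟩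

/-- The cocycle is not assumed normalised, so the unit needs the correction `-ω 1 1`. -/
instance : One (CocycleExtension hω) := ⟨⟨1, -ω 1 1⟩⟩

variable {hω}

@[simp] theorem base_add (x y : CocycleExtension hω) : (x + y).base = x.base + y.base := rfl
@[simp] theorem fiber_add (x y : CocycleExtension hω) : (x + y).fiber = x.fiber + y.fiber := rfl
@[simp] theorem base_zero : (0 : CocycleExtension hω).base = 0 := rfl
@[simp] theorem fiber_zero : (0 : CocycleExtension hω).fiber = 0 := rfl
@[simp] theorem base_smul (c : k) (x : CocycleExtension hω) : (c • x).base = c • x.base := rfl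
@[simp] theorem fiber_smul (c : k) (x : CocycleExtension hω) : (c • x).fiber = c * x.fiber := rfl
@[simp] theorem base_one : (1 : CocycleExtension hω).base = 1 := rfl
@[simp] theorem fiber_one : (1 : CocycleExtension hω).fiber = -ω 1 1 := rfl
@[simp] theorem base_mul (x y : CocycleExtension hω) : (x * y).base = x.base * y.base := rfl
@[simp] theorem fiber_mul (x y : CocycleExtension hω) : (x * y).fiber =
    f x.base * y.fiber + f y.base * x.fiber + ω x.base y.base := rfl

noncomputable instance : CommRing (CocycleExtension hω) where
  __ := (inferInstance : AddCommGroup (CocycleExtension hω))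
  mul_comm x y := by
    ext
    · exact mul_comm _ _
    · rw [fiber_mul, fiber_mul, hω.symm, add_comm (f x.base * _)]
  mul_assoc x y z := by
    ext
    · exact mul_assoc _ _ _
    · have := hω.cocycle x.base y.base z.base
      simp only [fiber_mul, base_mul, map_mul]
      linear_combination -this
  one_mul x := by
    ext
    · exact one_mul _
    · have := hω.cocycle 1 1 x.base
      simp only [mul_one, one_mul, map_one] at this
      simp only [fiber_mul, base_one, fiber_one, map_one, one_mul]
      linear_combination this
  mul_one x := by
    ext
    · exact mul_one _
    · have := hω.cocycle 1 1 x.base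
      simp only [mul_one, one_mul, map_one] at this
      simp only [fiber_mul, base_one, fiber_one, map_one, one_mul]
      rw [hω.symm x.base]
      linear_combination this
  left_distrib x y z := by
    ext
    · exact mul_add _ _ _
    · simp only [fiber_mul, fiber_add, base_add, map_add]; ring
  right_distrib x y z := by
    ext
    · exact add_mul _ _ _
    · simp only [fiber_mul, fiber_add, base_add, map_add, LinearMap.add_apply]; ring
  zero_mul x := by ext <;> simp
  mul_zero x := by ext <;> simp

noncomputable instance : Algebra k (CocycleExtension hω) :=
  Algebra.ofModule
    (fun r x y => by
      ext
      · exact smul_mul_assoc _ _ _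
      · simp only [fiber_mul, fiber_smul, base_smul, map_smul, LinearMap.smul_apply, smul_eq_mul]
        ring)
    (fun r x y => by
      ext
      · exact mul_smul_comm _ _ _
      · simp only [fiber_mul, fiber_smul, base_smul, map_smul, smul_eq_mul]
        ring)

variable (hω)

/-- The projection of the extension onto `B`. -/
noncomputable def proj : CocycleExtension hω →ₐ[k] B :=
  AlgHom.ofLinearMap
    { toFun := base
      map_add' := fun _ _ => rfl
      map_smul' := fun _ _ => rfl } rfl fun _ _ => rfl

/-- The generator of the kernel of the projection. -/
def gen : CocycleExtension hω := ⟨0, 1⟩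

variable {hω}

theorem proj_apply (x : CocycleExtension hω) : proj hω x = x.base := rfl

theorem proj_surjective : Function.Surjective (proj hω) := fun b => ⟨⟨b, 0⟩, rfl⟩

theorem eq_smul_gen {x : CocycleExtension hω} (hx : proj hω x = 0) : x = x.fiber • gen hω := by
  ext
  · rw [← proj_apply, hx, base_smul]; exact (smul_zero _).symm
  · exact (mul_one _).symm

theorem mul_gen (x : CocycleExtension hω) : x * gen hω = f x.base • gen hω := by
  ext
  · simp [gen]
  · simp [gen]

theorem mk_eq_add (b : B) (c : k) : (⟨b, c⟩ : CocycleExtension hω) = ⟨b, 0⟩ + c • gen hω := by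
  ext <;> simp [gen]

instance : Module.Finite k (RingHom.ker (proj hω)) := by
  refine Module.Finite.of_surjective (LinearMap.toSpanSingleton k _
    (⟨gen hω, rfl⟩ : RingHom.ker (proj hω))) fun x => ⟨x.1.fiber, ?_⟩
  exact Subtype.ext (eq_smul_gen x.2).symm

instance [IsNoetherianRing B] : IsNoetherianRing (CocycleExtension hω) :=
  (proj hω).isNoetherianRing_of_finite_ker proj_surjective

/-- By Krull's intersection theorem an element of all the powers is fixed by some member of the
ideal. But the ideal annihilates the generator, which is nonzero. -/
theorem exists_gen_notMem_pow [IsNoetherianRing B] :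
    ∃ j, gen hω ∉ RingHom.ker (f.comp (proj hω)) ^ j := by
  by_contra! h
  obtain ⟨⟨r, hr⟩, hr'⟩ := (Ideal.mem_iInf_smul_pow_eq_bot_iff (RingHom.ker (f.comp (proj hω)))
    (gen hω)).mp ((Submodule.mem_iInf _).mpr fun j => by
      rw [smul_eq_mul, Ideal.mul_top]; exact h j)
  have hr : f r.base = 0 := hr
  rw [smul_eq_mul, mul_gen, hr, zero_smul] at hr'
  exact one_ne_zero (congrArg fiber hr').symm

end CocycleExtension

-- The extension is truncated at an order where its generator survives. The lift of `B → B/(ker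
-- f)^j` then has the form `b ↦ (b, g b)`, and its multiplicativity says that `ω` is the coboundary
-- of `-g`.
open CocycleExtension in
theorem AlgHom.HasArtinianLifting.exists_coboundary {k B : Type u} [Field k] [CommRing B]
    [IsNoetherianRing B] [Algebra k B] {f : B →ₐ[k] k} (hf : f.HasArtinianLifting)
    {ω : B →ₗ[k] B →ₗ[k] k} (hω : f.IsSymmetricCocycle ω) :
    ∃ g : B →ₗ[k] k, ∀ a b, ω a b = f a * g b - g (a * b) + f b * g a := by
  obtain ⟨j, hj⟩ := exists_gen_notMem_pow (hω := hω)
  have hj0 : j ≠ 0 := by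
    rintro rfl
    exact hj (by simp)
  let F := f.comp (proj hω)
  have hmap : (RingHom.ker F).map (proj hω) = RingHom.ker f := by
    change Ideal.map _ (Ideal.comap (proj hω) (RingHom.ker f)) = _
    exact Ideal.map_comap_of_surjective _ proj_surjective _
  have := F.isMaximal_ker_of_augmentation
  have := f.isMaximal_ker_of_augmentation
  have := Ideal.isLocalRing_quotient_pow (RingHom.ker F) hj0
  have := Ideal.isLocalRing_quotient_pow (RingHom.ker f) hj0
  have := F.finite_quotient_ker_pow (IsNoetherian.noetherian _) j
  have := f.finite_quotient_ker_pow (IsNoetherian.noetherian _) j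
  let q := Ideal.Quotient.mkₐ k (RingHom.ker F ^ j)
  let ψ := Ideal.Quotient.mkₐ k (RingHom.ker f ^ j)
  let φ : (_ ⧸ RingHom.ker F ^ j) →ₐ[k] (B ⧸ RingHom.ker f ^ j) :=
    Ideal.Quotient.liftₐ _ (ψ.comp (proj hω)) fun a ha => by
      refine Ideal.Quotient.eq_zero_iff_mem.mpr ?_
      rw [← hmap, ← Ideal.map_pow]
      exact Ideal.mem_map_of_mem _ ha
  have hφq : ∀ x, φ (q x) = ψ (proj hω x) := fun x => rfl
  have hφ : Function.Surjective φ := fun z => by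
    obtain ⟨b, rfl⟩ := Ideal.Quotient.mk_surjective z
    exact ⟨q ⟨b, 0⟩, rfl⟩
  obtain ⟨θ, hθ⟩ := hf _ _ φ hφ ψ fun b hb hu => by
    have h1 := hu.pow j
    have h2 : ψ (b ^ j) = 0 := Ideal.Quotient.eq_zero_iff_mem.mpr (Ideal.pow_mem_pow hb j)
    rw [← map_pow, h2] at h1
    exact not_isUnit_zero h1
  have hgen : q (gen hω) ≠ 0 := fun h => hj (Ideal.Quotient.eq_zero_iff_mem.mp h)
  -- The powers of `ker F` map onto those of `ker f`, so truncation adds nothing to the kernel.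
  have hker : ∀ z, φ z = 0 → ∃ c : k, z = c • q (gen hω) := by
    intro z hz
    obtain ⟨x, rfl⟩ := Ideal.Quotient.mk_surjective z
    have h1 : proj hω x ∈ RingHom.ker f ^ j := Ideal.Quotient.eq_zero_iff_mem.mp hz
    rw [← hmap, ← Ideal.map_pow] at h1
    obtain ⟨w, hw, hwx⟩ := (Ideal.mem_map_iff_of_surjective _ proj_surjective).mp h1
    have h2 : proj hω (x - w) = 0 := by rw [map_sub, hwx, sub_self]
    refine ⟨(x - w).fiber, ?_⟩
    rw [← map_smul, ← eq_smul_gen h2]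
    refine Ideal.Quotient.eq.mpr ?_
    rwa [sub_sub_cancel]
  have hex : ∀ b, ∃ c : k, θ b = q ⟨b, c⟩ := by
    intro b
    obtain ⟨c, hc⟩ := hker (θ b - q ⟨b, 0⟩) (by rw [map_sub, hθ, hφq, sub_eq_zero]; rfl)
    exact ⟨c, by rw [mk_eq_add, map_add, map_smul, ← hc, add_sub_cancel]⟩
  -- This is where survival of the generator enters: the coordinate `g b` is unique, which makes `g`
  -- linear.
  have huniq : ∀ b (c c' : k), q ⟨b, c⟩ = q ⟨b, c'⟩ → c = c' := by
    intro b c c' h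
    rw [mk_eq_add b c, mk_eq_add b c', map_add, map_add, add_right_inj, map_smul, map_smul,
      ← sub_eq_zero, ← sub_smul] at h
    exact sub_eq_zero.mp ((smul_eq_zero.mp h).resolve_right hgen)
  choose g hg using hex
  let G : B →ₗ[k] k :=
    { toFun := g
      map_add' := fun a b => huniq (a + b) _ _ (by
        rw [← hg, map_add, hg, hg, ← map_add]; rfl)
      map_smul' := fun r b => huniq (r • b) _ _ (by
        rw [← hg, map_smul, hg, ← map_smul]; rfl) }
  have hmul : ∀ a b, g (a * b) = f a * g b + f b * g a + ω a b := fun a b =>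
    huniq (a * b) _ _ (by rw [← hg, map_mul, hg, hg, ← map_mul]; rfl)
  refine ⟨-G, fun a b => ?_⟩
  change ω a b = f a * -g b - -g (a * b) + f b * -g a
  rw [hmul]
  ring

theorem RepScheme.harr2_eq_bot_iff_hasArtinianLifting {k B : Type u} [Field k] [IsAlgClosed k]
    [CommRing B] [IsNoetherianRing B] [Algebra k B] (f : B →ₐ[k] k) :
    Harr2 k B (PointModule f) = ⊥ ↔ f.HasArtinianLifting :=
  ⟨hasArtinianLifting_of_harr2_eq_bot f, fun H => (harr2_pointModule_eq_bot_iff f).mpr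
    fun _ hω hsymm => H.exists_coboundary ⟨hω, hsymm⟩⟩

/-! ### Deformations as maps from the coordinate ring -/

namespace RepScheme

variable {k : Type u} [Field k] {A : Type v} [Ring A] [Algebra k A] {m n : ℕ}
  (π : FreeAlgebra k (Fin m) →ₐ[k] A) (hπ : Function.Surjective π)

/-- A representation over a local algebra reduces to the representation of `f` exactly if the
corresponding map from the coordinate ring is centred at `f`. -/
theorem repEquiv_reduces_iff (f : V n π →ₐ[k] k) {S : Type u} [CommRing S] [IsLocalRing S]
    [Algebra k S] (ψ : V n π →ₐ[k] S) :
    (∀ a, (repEquiv n π hπ S ψ a).map (residue S) =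
      (repEquiv n π hπ k f a).map (algebraMap k (ResidueField S))) ↔
    ∀ b, f b = 0 → ψ b ∈ maximalIdeal S := by
  -- By the adjunction over the residue field, the two reductions agree exactly if the points `α`
  -- and `β` do.
  let α : V n π →ₐ[k] ResidueField S := (IsScalarTower.toAlgHom k S (ResidueField S)).comp ψ
  let β : V n π →ₐ[k] ResidueField S := (Algebra.ofId k (ResidueField S)).comp f
  have h1 : (∀ a, (repEquiv n π hπ S ψ a).map (residue S) =
      (repEquiv n π hπ k f a).map (algebraMap k (ResidueField S))) ↔
      repEquiv n π hπ _ α = repEquiv n π hπ _ β :=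
    ⟨fun h => AlgHom.ext fun a => h a, fun h a => DFunLike.congr_fun h a⟩
  rw [h1, (repEquiv n π hπ _).injective.eq_iff]
  constructor
  · intro h b hb
    rw [← residue_eq_zero_iff]
    have : residue S (ψ b) = algebraMap k (ResidueField S) (f b) := DFunLike.congr_fun h b
    rw [this, hb, map_zero]
  · intro h
    ext1 b
    have h2 := (residue_eq_zero_iff _).mpr (h _ (f.sub_algebraMap_mem_ker b))
    rw [map_sub, ψ.commutes, map_sub, sub_eq_zero] at h2
    exact h2

theorem deformation_map_surjective_iff (f : V n π →ₐ[k] k) :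
    (∀ (S T : Type u) [CommRing S] [IsLocalRing S] [Algebra k S] [Module.Finite k S]
        [CommRing T] [IsLocalRing T] [Algebra k T] [Module.Finite k T]
        (φ : S →ₐ[k] T) (hφ : Function.Surjective φ),
        Function.Surjective (Deformation.map (repEquiv n π hπ k f) φ hφ)) ↔
      f.HasArtinianLifting := by
  constructor
  · intro H S T _ _ _ _ _ _ _ _ φ hφ ψ hψ
    obtain ⟨⟨σ, hσ⟩, h⟩ := H S T φ hφ
      ⟨repEquiv n π hπ T ψ, (repEquiv_reduces_iff π hπ f ψ).mpr hψ⟩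
    obtain ⟨θ, rfl⟩ := (repEquiv n π hπ S).surjective σ
    have h1 : repEquiv n π hπ T (φ.comp θ) = repEquiv n π hπ T ψ := congrArg Subtype.val h
    exact ⟨θ, DFunLike.congr_fun ((repEquiv n π hπ T).injective h1)⟩
  · rintro H S T _ _ _ _ _ _ _ _ φ hφ ⟨τ, hτ⟩
    obtain ⟨ψ, rfl⟩ := (repEquiv n π hπ T).surjective τ
    have hψ := (repEquiv_reduces_iff π hπ f ψ).mp hτ
    obtain ⟨θ, hθ⟩ := H S T φ hφ ψ hψ
    refine ⟨⟨repEquiv n π hπ S θ, (repEquiv_reduces_iff π hπ f θ).mpr fun b hb =>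
      mem_maximalIdeal_of_map_mem (φ : S →+* T) ?_⟩, Subtype.ext ?_⟩
    · rw [RingHom.coe_coe, hθ]
      exact hψ b hb
    · exact congrArg (repEquiv n π hπ T) (AlgHom.ext hθ : φ.comp θ = ψ)

end RepScheme

theorem mainTheorem3 {k : Type u} [Field k] [IsAlgClosed k] {A : Type v} [Ring A] [Algebra k A]
    {m : ℕ} (π : FreeAlgebra k (Fin m) →ₐ[k] A) (hπ : Function.Surjective π) (n : ℕ)
    (M : A →ₐ[k] Matrix (Fin n) (Fin n) k)
    (f : RepScheme.V n π →ₐ[k] k) (hf : RepScheme.repEquiv n π hπ k f = M) :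
    List.TFAE [
      RepScheme.IsRegularPoint (RepScheme.underlyingPoint f),
      ∀ (S T : Type u) [CommRing S] [IsLocalRing S] [Algebra k S] [Module.Finite k S]
        [CommRing T] [IsLocalRing T] [Algebra k T] [Module.Finite k T]
        (φ : S →ₐ[k] T) (hφ : Function.Surjective φ),
        Function.Surjective (RepScheme.Deformation.map M φ hφ),
      RepScheme.Harr2 k (RepScheme.V n π) (RepScheme.PointModule f) = ⊥] := by
  subst hf
  tfae_have 1 ↔ 2 := (RepScheme.isRegularPoint_iff_hasArtinianLifting f).trans
    (RepScheme.deformation_map_surjective_iff π hπ f).symm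
  tfae_have 3 ↔ 2 := (RepScheme.harr2_eq_bot_iff_hasArtinianLifting f).trans
    (RepScheme.deformation_map_surjective_iff π hπ f).symm
  tfae_finish
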